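/- Let $N\ge 0$, let $\Omega\subset\mathbb C$ be open, connected and simply connected, $\xi_0\in\Omega$, and write $\xi=\xi^1+i\xi^2$, $\partial=\tfrac12(\partial_1-i\partial_2)$, $\bar\partial=\tfrac12(\partial_1+i\partial_2)$. Let $f:\Omega\to\mathbb C^{N+1}\setminus\{0\}$ be of class $C^2$, put $P=\mathbf 1-\frac{f f^\dagger}{f^\dagger f}$, and suppose that $f$ solves the $\mathbb CP^N$ sigma model equations $$P\Big[\partial\bar\partial f-\tfrac{1}{f^\dagger f}\big((f^\dagger\bar\partial f)\,\partial f+(f^\dagger\partial f)\,\bar\partial f\big)\Big]=0\quad\text{on }\Omega .$$ Let $\mathfrak{su}(N+1)$ be the space of trace-free skew-Hermitian matrices with the inner product $(A,B)=-2(N+1)\operatorname{tr}(AB)$. A Euclidean motion is an affine isometry of this space. For a $C^2$ map $X$ into it, the first fundamental form is $\mathrm I_X(v,w)=(dX(v),dX(w))$ and the second fundamental form is $\mathrm{II}_X(v,w)=(D^2X(v,w))^\perp$, where $\perp$ is the orthogonal projection onto the normal space $(\operatorname{im} dX)^\perp$; the normal connection is $\nabla^\perp_v\eta=(d\eta(v))^\perp$.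 (a) The formula $$X(\xi)=i\int_\gamma\big(-[\partial P,P]\,d\xi+[\bar\partial P,P]\,d\bar\xi\big),$$ with $\gamma$ any piecewise $C^1$ curve in $\Omega$ from $\xi_0$ to $\xi$, does not depend on the choice of $\gamma$ and defines a map $X:\Omega\to\mathfrak{su}(N+1)$ of class $C^2$ with $dX=i(-[\partial P,P]\,d\xi+[\bar\partial P,P]\,d\bar\xi)$; $X$ is an immersion at every point at which the determinant of $\mathrm I_X$ does not vanish. (b) This surface is determined by its first and second fundamental forms uniquely up to Euclidean motions: let $U\subset\Omega$ be open and connected, with $\det\mathrm I_X\neq0$ on $U$, and let $Y:U\to\mathfrak{su}(N+1)$ be any $C^2$ map. Then each of the following two conditions is equivalent to the existence of a Euclidean motion $M$ with $Y=M\circ X$ on $U$: (i) $\mathrm I_Y=\mathrm I_X$ on $U$, and there is a linear isometry $R$ of $\mathfrak{su}(N+1)$, independent of the point, with $\mathrm{II}_Y=R\,\mathrm{II}_X$ on $U$ (in particular, $\mathrm I_Y=\mathrm I_X$ and $\mathrm{II}_Y=\mathrm{II}_X$ suffice); (ii) $\mathrm I_Y=\mathrm I_X$ on $U$, and there is an isometric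 isomorphism $\Phi$ from the normal bundle of $X|_U$ to that of $Y$ which carries $C^1$ normal fields to $C^1$ normal fields, is compatible with the normal connections, and satisfies $\mathrm{II}_Y=\Phi\,\mathrm{II}_X$. -/

import Mathlib

noncomputable section

namespace CPN

open Complex Matrix
open scoped ComplexOrder

/-- Square complex matrices of size `N + 1`. -/
abbrev Mat (N : ℕ) : Type := Matrix (Fin (N + 1)) (Fin (N + 1)) ℂ

/-! ### The Euclidean space `su(N+1)` -/

/-- Trace-free skew-Hermitian matrices, as a real subspace of all matrices. -/
def suSubmodule (N : ℕ) : Submodule ℝ (Mat N) where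
  carrier := {A | Aᴴ = -A ∧ A.trace = 0}
  add_mem' := by
    rintro A B ⟨hA, hA'⟩ ⟨hB, hB'⟩
    refine ⟨?_, ?_⟩
    · rw [conjTranspose_add, hA, hB, neg_add]
    · rw [trace_add, hA', hB', add_zero]
  zero_mem' := by simp
  smul_mem' := by
    rintro c A ⟨hA, hA'⟩
    refine ⟨?_, ?_⟩
    · rw [conjTranspose_smul, hA, star_trivial, smul_neg]
    · rw [trace_smul, hA', smul_zero]

/-- The Lie algebra `su(N+1)`. It is kept apart from the subtype of matrices because its norm
comes from the Killing form. -/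
def Su (N : ℕ) : Type := suSubmodule N

instance (N : ℕ) : AddCommGroup (Su N) := inferInstanceAs (AddCommGroup (suSubmodule N))

instance (N : ℕ) : Module ℝ (Su N) := inferInstanceAs (Module ℝ (suSubmodule N))

/-- The matrix underlying an element of `su(N+1)`. -/
def Su.mat {N : ℕ} : Su N →ₗ[ℝ] Mat N := (suSubmodule N).subtype

theorem Su.mat_injective {N : ℕ} : Function.Injective (Su.mat (N := N)) :=
  Subtype.coe_injective

theorem Su.conjTranspose_mat {N : ℕ} (A : Su N) : A.matᴴ = -A.mat := A.2.1

theorem Su.trace_mat {N : ℕ} (A : Su N) : A.mat.trace = 0 := A.2.2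

/-- Every trace-free skew-Hermitian matrix is an element of `su(N+1)`. -/
theorem Su.exists_mat_eq {N : ℕ} (A : Mat N) (hA : Aᴴ = -A) (hA' : A.trace = 0) :
    ∃ a : Su N, a.mat = A := ⟨⟨A, hA, hA'⟩, rfl⟩

/-- The inner product `(A, B) = -2 (N + 1) tr (A B)`: the negative of the Killing form. The trace
is a real number, so that taking its real part loses nothing. -/
abbrev suCore (N : ℕ) : InnerProductSpace.Core ℝ (Su N) where
  inner A B := -(2 * ((N : ℝ) + 1) * (A.mat * B.mat).trace.re)
  conj_inner_symm A B := by
    rw [conj_trivial, trace_mul_comm]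
  re_inner_nonneg A := by
    have h : (0 : ℂ) ≤ (A.matᴴ * A.mat).trace :=
      (posSemidef_conjTranspose_mul_self A.mat).trace_nonneg
    rw [Su.conjTranspose_mat, neg_mul, trace_neg] at h
    have h2 := (Complex.le_def.1 h).1
    simp only [zero_re, neg_re] at h2
    simp only [RCLike.re_to_real]
    have h3 : (0 : ℝ) ≤ 2 * ((N : ℝ) + 1) := by positivity
    nlinarith [mul_nonneg h3 h2]
  add_left A B C := by
    rw [map_add, add_mul, trace_add, add_re]; ring
  smul_left A B r := by
    rw [map_smul, Matrix.smul_mul, trace_smul, Complex.smul_re, conj_trivial, smul_eq_mul]; ring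
  definite A hA := by
    have h : (0 : ℂ) ≤ (A.matᴴ * A.mat).trace :=
      (posSemidef_conjTranspose_mul_self A.mat).trace_nonneg
    have h3 : (2 * ((N : ℝ) + 1)) ≠ 0 := by positivity
    have h4 : (A.mat * A.mat).trace.re = 0 := by
      rcases mul_eq_zero.1 (neg_eq_zero.1 hA) with h5 | h5
      · exact absurd h5 h3
      · exact h5
    have h6 : (A.matᴴ * A.mat).trace = 0 := by
      apply Complex.ext
      · rw [Su.conjTranspose_mat, neg_mul, trace_neg, neg_re, h4, neg_zero, zero_re]
      · exact (Complex.le_def.1 h).2.symm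
    have h7 := trace_conjTranspose_mul_self_eq_zero_iff.1 h6
    exact Su.mat_injective (h7.trans (map_zero _).symm)

instance (N : ℕ) : NormedAddCommGroup (Su N) := (suCore N).toNormedAddCommGroup

instance (N : ℕ) : InnerProductSpace ℝ (Su N) := InnerProductSpace.ofCore (suCore N).toCore

instance (N : ℕ) : FiniteDimensional ℝ (Su N) :=
  inferInstanceAs (FiniteDimensional ℝ (suSubmodule N))

theorem inner_def {N : ℕ} (A B : Su N) :
    inner ℝ A B = -(2 * ((N : ℝ) + 1) * (A.mat * B.mat).trace.re) := rfl

/-! ### The `ℂP^N` model -/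

/-- The derivative `∂ = (∂₁ - i ∂₂) / 2` of a complex function on the plane. -/
def wd (u : ℂ → ℂ) (z : ℂ) : ℂ := (fderiv ℝ u z 1 - I * fderiv ℝ u z I) / 2

/-- The derivative `∂̄ = (∂₁ + i ∂₂) / 2` of a complex function on the plane. -/
def wdbar (u : ℂ → ℂ) (z : ℂ) : ℂ := (fderiv ℝ u z 1 + I * fderiv ℝ u z I) / 2

variable {N : ℕ}

/-- The projector `P = 1 - f f† / (f† f)` onto the orthogonal complement of the line of `f`. -/
def proj (f : ℂ → Fin (N + 1) → ℂ) (z : ℂ) : Mat N :=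
  1 - (star (f z) ⬝ᵥ f z)⁻¹ • vecMulVec (f z) (star (f z))

/-- `f` is a solution of the `ℂP^N` model on `Ω`: a nowhere vanishing `C²` field of homogeneous
coordinates with
`P [∂∂̄f - (f† f)⁻¹ ((f† ∂̄f) ∂f + (f† ∂f) ∂̄f)] = 0`. -/
structure IsSolution (Ω : Set ℂ) (f : ℂ → Fin (N + 1) → ℂ) : Prop where
  contDiffOn : ContDiffOn ℝ 2 f Ω
  ne_zero : ∀ z ∈ Ω, f z ≠ 0
  eulerLagrange : ∀ z ∈ Ω,
    let df : Fin (N + 1) → ℂ := fun j => wd (fun ζ => f ζ j) z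
    let dbf : Fin (N + 1) → ℂ := fun j => wdbar (fun ζ => f ζ j) z
    let ddbf : Fin (N + 1) → ℂ := fun j => wd (wdbar fun ζ => f ζ j) z
    proj f z *ᵥ (ddbf - (star (f z) ⬝ᵥ f z)⁻¹ •
      ((star (f z) ⬝ᵥ dbf) • df + (star (f z) ⬝ᵥ df) • dbf)) = 0

/-- The matrix `∂P`. -/
def dProj (f : ℂ → Fin (N + 1) → ℂ) (z : ℂ) : Mat N :=
  Matrix.of fun j k => wd (fun ζ => proj f ζ j k) z

/-- The matrix `∂̄P`. -/
def dbarProj (f : ℂ → Fin (N + 1) → ℂ) (z : ℂ) : Mat N :=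
  Matrix.of fun j k => wdbar (fun ζ => proj f ζ j k) z

/-- The `(j, k)` entry of the matrix-valued 1-form `i (-[∂P, P] dξ + [∂̄P, P] dξ̄)`. -/
def weierstrassForm (f : ℂ → Fin (N + 1) → ℂ) (j k : Fin (N + 1)) (z : ℂ) : ℂ →L[ℝ] ℂ :=
  I • (-(⁅dProj f z, proj f z⁆ j k) • ContinuousLinearMap.id ℝ ℂ
    + ⁅dbarProj f z, proj f z⁆ j k • (conjCLE : ℂ →L[ℝ] ℂ))

/-- Continuous curves that are `C¹` on each interval of a finite subdivision. -/
def PiecewiseC1 {a b : ℂ} (γ : Path a b) : Prop :=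
  ∃ (n : ℕ) (t : ℕ → ℝ), Monotone t ∧ t 0 = 0 ∧ t n = 1 ∧
    ∀ m < n, ContDiffOn ℝ 1 γ.extend (Set.Icc (t m) (t (m + 1)))

/-- `X` is given on `Ω` by the generalized Weierstrass formula: `X ξ` is the integral of
`i (-[∂P, P] dξ + [∂̄P, P] dξ̄)` along every curve in `Ω` from `ξ₀` to `ξ`. -/
def IsWeierstrassMap (Ω : Set ℂ) (f : ℂ → Fin (N + 1) → ℂ) (ξ₀ : ℂ) (X : ℂ → Su N) : Prop :=
  ∀ ξ ∈ Ω, ∀ γ : Path ξ₀ ξ, (∀ s, γ s ∈ Ω) → PiecewiseC1 γ → ∀ j k,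
    CurveIntegrable (weierstrassForm f j k) γ ∧
      (X ξ).mat j k = curveIntegral (weierstrassForm f j k) γ

/-! ### Fundamental forms of a map from the plane to `su(N+1)` -/

/-- The first fundamental form. -/
def firstForm (X : ℂ → Su N) (z v w : ℂ) : ℝ := inner ℝ (fderiv ℝ X z v) (fderiv ℝ X z w)

/-- The determinant of the first fundamental form in the real coordinates. -/
def metricDet (X : ℂ → Su N) (z : ℂ) : ℝ :=
  firstForm X z 1 1 * firstForm X z I I - firstForm X z 1 I ^ 2

/-- The normal space: the orthogonal complement of the tangent space. -/
def normalSpace (X : ℂ → Su N) (z : ℂ) : Submodule ℝ (Su N) :=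
  (LinearMap.range (fderiv ℝ X z : ℂ →ₗ[ℝ] Su N))ᗮ

/-- The normal part of a vector. -/
def normalPart (X : ℂ → Su N) (z : ℂ) (A : Su N) : Su N := (normalSpace X z).starProjection A

/-- The second fundamental form: the normal part of the second derivative. -/
def secondForm (X : ℂ → Su N) (z v w : ℂ) : Su N :=
  normalPart X z (fderiv ℝ (fderiv ℝ X) z v w)

/-- `η` is a `C¹` normal field along `X` on `U`. -/
def IsNormalField (U : Set ℂ) (X η : ℂ → Su N) : Prop :=
  ContDiffOn ℝ 1 η U ∧ ∀ z ∈ U, η z ∈ normalSpace X z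

/-- `Φ` is an isometric isomorphism from the normal bundle of `X` to that of `Y` over `U` which
carries the normal connection `∇^⊥_v η = (dη(v))^⊥` of `X` to that of `Y`. Only the values of `Φ z`
on the normal space of `X` at `z` matter. -/
structure IsNormalIsometry (U : Set ℂ) (X Y : ℂ → Su N) (Φ : ℂ → Su N →ₗ[ℝ] Su N) : Prop where
  bijOn : ∀ z ∈ U, Set.BijOn (Φ z) (normalSpace X z) (normalSpace Y z)
  norm_map : ∀ z ∈ U, ∀ ν ∈ normalSpace X z, ‖Φ z ν‖ = ‖ν‖
  isNormalField : ∀ η, IsNormalField U X η → IsNormalField U Y fun z => Φ z (η z)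
  parallel : ∀ η, IsNormalField U X η → ∀ z ∈ U, ∀ v,
    normalPart Y z (fderiv ℝ (fun ζ => Φ ζ (η ζ)) z v) = Φ z (normalPart X z (fderiv ℝ η z v))

/-- `X` and `Y` differ on `U` by a Euclidean motion of `su(N+1)`. -/
def Congruent (U : Set ℂ) (X Y : ℂ → Su N) : Prop :=
  ∃ M : Su N ≃ᵃⁱ[ℝ] Su N, ∀ z ∈ U, Y z = M (X z)

end CPN

end

/-! (a) In real terms the form sends `v` to `[dP(-iv), P]`, a commutator of Hermitian matrices,
hence skew-Hermitian and trace-free. Its exterior derivative is `[ΔP, P]`. With `Q = 1 - P`, the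
field equations amount to `P ΔP Q = 0`; the adjoint of this is `Q ΔP P = 0`, so `ΔP` commutes with
`P` (`IsSolution.lie_projLaplacian_proj`) and the form is closed. A closed form on a simply
connected open set has a primitive, obtained as a section of the covering space of germs of local
primitives, and the integral along any piecewise `C¹` curve is a difference of its values.

(b) By the Koszul formula the first fundamental form determines the Christoffel symbols `Γ`, so `D²X
= dX ∘ Γ + II_X` and `D²Y = dY ∘ Γ + II_Y` with one and the same continuous `Γ`. A solution of `dE =
E ∘ Γ` on a connected open set is zero as soon as it vanishes at a point (`eq_zero_of_parallel`).

For (i), the terms in `II` cancel in the derivative of `R dX - dY`, so the image of this map is the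
same subspace at all points of `U`. The vectors `II_Y = R II_X` are normal to both `R dX` and `dY`,
hence lie in its orthogonal complement `K`. Equality of Gram forms yields an isometry `T` that fixes
`K` pointwise and carries `R dX` to `dY` at one point; then `T R dX - dY` is parallel too, and
vanishes everywhere.

For (ii), the isometry `S` which is `dY ∘ dX⁻¹` on tangent vectors and `Φ` on normal vectors is
constant, by the Gauss and Weingarten formulas. In both cases `dY` is a constant isometry applied to
`dX`, and integration gives the motion. -/

noncomputable section

open Set Filter Topology MeasureTheory

/-! ### Closed `1`-forms on simply connected open sets -/

section Primitive

variable {E F : Type*} [NormedAddCommGroup E] [NormedSpace ℝ E]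
  [NormedAddCommGroup F] [NormedSpace ℝ F]

/-- A type with the discrete topology. -/
def DiscreteCopy (F : Type*) : Type _ := F

instance : TopologicalSpace (DiscreteCopy F) := ⊥

instance : DiscreteTopology (DiscreteCopy F) := ⟨rfl⟩

/-- The covering space of germs of primitives of a `1`-form, given by primitives `g i` on balls
around the points `i` of an open set. -/
def primitiveCore {Ω : Set E} (ω : E → E →L[ℝ] F) (r : Ω → ℝ) (hr : ∀ i, 0 < r i)
    (g : Ω → E → F) (hg : ∀ i : Ω, ∀ z ∈ Metric.ball (i : E) (r i), HasFDerivAt (g i) (ω z) z) :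
    FiberBundleCore Ω Ω (DiscreteCopy F) where
  baseSet i := Subtype.val ⁻¹' Metric.ball (i : E) (r i)
  isOpen_baseSet i := Metric.isOpen_ball.preimage continuous_subtype_val
  indexAt := id
  mem_baseSet_at i := Metric.mem_ball_self (hr i)
  coordChange i j z w := (show F from w) + (g i z - g j z)
  coordChange_self i z _ w := by
    rw [sub_self]
    exact add_zero (show F from w)
  continuousOn_coordChange i j := by
    -- Two primitives of one form differ by a constant on the intersection of two balls, which is
    -- convex. The transition map is thus a fixed translation of the fibre, which is what continuity
    -- for the discrete topology demands.
    have hc := ((convex_ball (i : E) (r i)).inter (convex_ball (j : E) (r j))).isPreconnected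
    have ho := (Metric.isOpen_ball (x := (i : E)) (ε := r i)).inter
      (Metric.isOpen_ball (x := (j : E)) (ε := r j))
    have hd : ∀ z ∈ Metric.ball (i : E) (r i) ∩ Metric.ball (j : E) (r j),
        HasFDerivAt (fun z => g i z - g j z) (0 : E →L[ℝ] F) z := fun z hz => by
      simpa using (hg i z hz.1).fun_sub (hg j z hz.2)
    obtain ⟨c, hc⟩ := ho.exists_is_const_of_fderiv_eq_zero (𝕜 := ℝ) hc
      (fun z hz => (hd z hz).differentiableAt.differentiableWithinAt)
      (fun z hz => (hd z hz).fderiv)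
    have hcont : Continuous fun w : DiscreteCopy F => (show DiscreteCopy F from (show F from w) + c) :=
      continuous_of_discreteTopology
    refine (hcont.comp continuous_snd).continuousOn.congr ?_
    rintro ⟨z, w⟩ ⟨hz, -⟩
    change (show F from w) + (g i z - g j z) = (show F from w) + c
    rw [hc z hz]
  coordChange_comp i j k z _ w := by
    change (show F from w) + (g i z - g j z) + (g j z - g k z) = (show F from w) + (g i z - g k z)
    abel

/-- A closed `1`-form on a simply connected open set has a primitive. -/
theorem IsSimplyConnected.exists_forall_hasFDerivAt_of_fderiv_symmetric [CompleteSpace F]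
    {Ω : Set E} (hΩc : IsSimplyConnected Ω) (hΩ : IsOpen Ω) {ω : E → E →L[ℝ] F}
    (hω : DifferentiableOn ℝ ω Ω)
    (hsymm : ∀ z ∈ Ω, ∀ v w, fderiv ℝ ω z v w = fderiv ℝ ω z w v) :
    ∃ G : E → F, ∀ z ∈ Ω, HasFDerivAt G (ω z) z := by
  classical
  have h1 : ∀ i : Ω, ∃ r > 0, Metric.ball (i : E) r ⊆ Ω := fun i =>
    Metric.isOpen_iff.1 hΩ i i.2
  choose r hr hsub using h1
  have h2 : ∀ i : Ω, ∃ g : E → F, ∀ z ∈ Metric.ball (i : E) (r i), HasFDerivAt g (ω z) z := fun i =>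
    (convex_ball (i : E) (r i)).exists_forall_hasFDerivAt_of_fderiv_symmetric Metric.isOpen_ball
      (hω.mono (hsub i)) fun z hz => hsymm z (hsub i hz)
  choose g hg using h2
  let Z := primitiveCore ω r hr g hg
  -- Discrete fibres make the bundle a covering, and simple connectedness lifts the identity of `Ω`
  -- to a global section, that is, a coherent choice of constants of integration.
  have hcov : IsCoveringMap (Bundle.TotalSpace.proj : Z.TotalSpace → Ω) :=
    FiberBundle.isCoveringMap (F := DiscreteCopy F)
  have := hΩc.simplyConnectedSpace
  have := hΩ.locallyPathConnectedSpace
  obtain ⟨x₀, hx₀⟩ := hΩc.nonempty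
  obtain ⟨s, ⟨-, hs⟩, -⟩ := hcov.existsUnique_continuousMap_lifts (ContinuousMap.id Ω) ⟨x₀, hx₀⟩
    (⟨⟨x₀, hx₀⟩, (0 : F)⟩ : Z.TotalSpace) rfl
  have hs' : ∀ z, (s z).proj = z := fun z => congrFun hs z
  -- Since `indexAt` is the identity, `v z` is the constant relative to the primitive `g z` chosen
  -- at `z` itself; the germ therefore has the value `v z + g z z` at `z`. Near `i` the coordinate
  -- in the chart of `i` is constant, the fibre being discrete.
  let v : Ω → F := fun z => (s z).2
  have hloc : ∀ i : Ω, ∃ c : F, ∀ᶠ z in 𝓝 i, v z + g z z = g i z + c := by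
    intro i
    have hi : s i ∈ (Z.localTriv i).source := by
      rw [FiberBundleCore.mem_localTriv_source, hs']
      exact Z.mem_baseSet_at i
    have hcont : ContinuousAt (fun z => (Z.localTriv i (s z)).2) i :=
      continuousAt_snd.comp (((Z.localTriv i).continuousAt hi).comp s.continuous.continuousAt)
    rw [ContinuousAt, nhds_discrete (DiscreteCopy F), tendsto_pure] at hcont
    refine ⟨(Z.localTriv i (s i)).2, hcont.mono fun z hz => ?_⟩
    have hz' : (Z.localTriv i (s z)).2 = v z + (g z z - g i z) := by
      change v z + (g (s z).proj (s z).proj - g i (s z).proj) = _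
      rw [hs']
    rw [← hz, hz']
    abel
  refine ⟨fun z => if hz : z ∈ Ω then v ⟨z, hz⟩ + g ⟨z, hz⟩ z else 0, fun z hz => ?_⟩
  obtain ⟨c, hc⟩ := hloc ⟨z, hz⟩
  refine ((hg ⟨z, hz⟩ z (Metric.mem_ball_self (hr _))).add_const c).congr_of_eventuallyEq ?_
  have hc' : ∀ᶠ y in 𝓝[Ω] z, ∀ hy : y ∈ Ω, v ⟨y, hy⟩ + g ⟨y, hy⟩ y = g ⟨z, hz⟩ y + c := by
    rw [nhds_subtype_eq_comap, eventually_comap] at hc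
    exact nhdsWithin_le_nhds (hc.mono fun y hy hyΩ => hy ⟨y, hyΩ⟩ rfl)
  rw [hΩ.nhdsWithin_eq hz] at hc'
  filter_upwards [hc', hΩ.mem_nhds hz] with y hy hyΩ
  rw [dif_pos hyΩ, hy hyΩ]

end Primitive

namespace CPN

open Complex

/-! ### Piecewise `C¹` curves -/

/-- The fundamental theorem of calculus for curve integrals along piecewise `C¹` curves. -/
theorem PiecewiseC1.curveIntegral_eq_sub {a b : ℂ} {γ : Path a b} (hγ : PiecewiseC1 γ)
    {F : Type*} [NormedAddCommGroup F] [NormedSpace ℝ F] [CompleteSpace F]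
    {Ω : Set ℂ} {ω : ℂ → ℂ →L[ℝ] F} {G : ℂ → F} (hω : ContinuousOn ω Ω)
    (hG : ∀ z ∈ Ω, HasFDerivAt G (ω z) z) (hγΩ : ∀ s, γ s ∈ Ω) :
    CurveIntegrable ω γ ∧ curveIntegral ω γ = G b - G a := by
  obtain ⟨n, t, ht, ht0, htn, hd⟩ := hγ
  have hmem : ∀ x, γ.extend x ∈ Ω := fun x => hγΩ _
  have hpiece : ∀ m < n, IntervalIntegrable (curveIntegralFun ω γ) volume (t m) (t (m + 1)) ∧
      ∫ x in t m..t (m + 1), curveIntegralFun ω γ x =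
        G (γ.extend (t (m + 1))) - G (γ.extend (t m)) := by
    intro m hm
    -- The subdivision is only monotone, so a piece may degenerate to a point.
    rcases (ht m.le_succ).eq_or_lt with heq | hlt
    · simp only [Nat.succ_eq_add_one] at heq
      rw [heq]
      simp
    simp only [Nat.succ_eq_add_one] at hlt
    have h0 : 0 ≤ t m := ht0 ▸ ht (Nat.zero_le m)
    have h1 : t (m + 1) ≤ 1 := htn ▸ ht hm
    have hderiv : ∀ x ∈ Ioo (t m) (t (m + 1)),
        HasDerivAt γ.extend (derivWithin γ.extend (Icc (t m) (t (m + 1))) x) x := fun x hx =>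
      ((hd m hm).differentiableOn one_ne_zero x (Ioo_subset_Icc_self hx)).hasDerivWithinAt.hasDerivAt
        (Icc_mem_nhds hx.1 hx.2)
    -- The integrand is defined with the derivative within `[0, 1]`; inside a piece it agrees with
    -- the derivative within that piece, and endpoints do not affect the integral.
    have hfun : ∀ x ∈ Ioo (t m) (t (m + 1)), curveIntegralFun ω γ x =
        ω (γ.extend x) (derivWithin γ.extend (Icc (t m) (t (m + 1))) x) := fun x hx => by
      rw [curveIntegralFun_def, derivWithin_of_mem_nhds
        (Icc_mem_nhds (h0.trans_lt hx.1) (hx.2.trans_le h1)), (hderiv x hx).deriv]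
    have hcont : ContinuousOn (fun x => ω (γ.extend x)
        (derivWithin γ.extend (Icc (t m) (t (m + 1))) x)) (Icc (t m) (t (m + 1))) :=
      (hω.comp γ.continuous_extend.continuousOn fun x _ => hmem x).clm_apply
        ((hd m hm).continuousOn_derivWithin (uniqueDiffOn_Icc hlt) le_rfl)
    have hint : IntervalIntegrable (curveIntegralFun ω γ) volume (t m) (t (m + 1)) := by
      refine (hcont.intervalIntegrable_of_Icc hlt.le).congr_uIoo ?_
      rw [uIoo_of_le hlt.le]
      exact fun x hx => (hfun x hx).symm
    refine ⟨hint, intervalIntegral.integral_eq_sub_of_hasDerivAt_of_le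
      (f := fun x => G (γ.extend x)) hlt.le ?_ ?_ hint⟩
    · have hGc : ContinuousOn G Ω := fun z hz => (hG z hz).continuousAt.continuousWithinAt
      exact hGc.comp γ.continuous_extend.continuousOn fun x _ => hmem x
    · intro x hx
      rw [hfun x hx]
      exact (hG _ (hmem x)).comp_hasDerivAt x (hderiv x hx)
  have hI := IntervalIntegrable.trans_iterate fun m hm => (hpiece m hm).1
  rw [ht0, htn] at hI
  refine ⟨hI, ?_⟩
  rw [curveIntegral_def, ← ht0, ← htn,
    ← intervalIntegral.sum_integral_adjacent_intervals fun m hm => (hpiece m hm).1,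
    Finset.sum_congr rfl fun m hm => (hpiece m (Finset.mem_range.1 hm)).2,
    Finset.sum_range_sub fun m => G (γ.extend (t m)), ht0, htn, γ.extend_zero, γ.extend_one]

/-- A piecewise `C¹` curve can be prolonged by a segment. -/
theorem PiecewiseC1.trans_segment {a b : ℂ} {γ : Path a b} (hγ : PiecewiseC1 γ) (c : ℂ) :
    PiecewiseC1 (γ.trans (Path.segment b c)) := by
  obtain ⟨n, t, ht, ht0, htn, hd⟩ := hγ
  have hle : ∀ m ≤ n, t m ≤ 1 := fun m hm => htn ▸ ht hm
  -- The concatenation runs `γ` on `[0, 1/2]`, so the old nodes are halved, the last one becoming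
  -- `1/2`, and the segment fills the new piece `[1/2, 1]`.
  refine ⟨n + 1, fun m => if m ≤ n then t m / 2 else 1, ?_, by simp [ht0], by simp, ?_⟩
  · intro m k hmk
    dsimp only
    split_ifs with h1 h2 h2
    · linarith [ht hmk]
    · linarith [hle m h1]
    · omega
    · rfl
  · intro m hm
    have hmn : m ≤ n := by omega
    rcases hmn.eq_or_lt with rfl | hlt
    · simp only [le_refl, if_true, htn, Nat.not_succ_le_self, if_false]
      have hc : ContDiff ℝ 1 fun x : ℝ => AffineMap.lineMap b c (2 * x - 1) := by
        simp only [AffineMap.lineMap_apply_module']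
        fun_prop
      refine hc.contDiffOn.congr fun x hx => ?_
      rw [Path.extend_trans_of_half_le _ _ hx.1,
        Path.extend_apply _ ⟨by linarith [hx.1], by linarith [hx.2]⟩]
      rfl
    · have h' : m + 1 ≤ n := hlt
      simp only [hmn, if_true, h']
      have hc : ContDiffOn ℝ 1 (fun x : ℝ => γ.extend (2 * x)) (Icc (t m / 2) (t (m + 1) / 2)) := by
        refine (hd m hlt).comp (by fun_prop) fun x hx => ⟨?_, ?_⟩ <;> linarith [hx.1, hx.2]
      exact hc.congr fun x hx => Path.extend_trans_of_le_half _ _ (by linarith [hx.2, hle _ h'])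

/-- Any two points of a connected open set are joined by a piecewise `C¹` curve. -/
theorem exists_piecewiseC1 {Ω : Set ℂ} (hΩ : IsOpen Ω) (hΩc : IsPreconnected Ω) {a b : ℂ}
    (ha : a ∈ Ω) (hb : b ∈ Ω) : ∃ γ : Path a b, (∀ s, γ s ∈ Ω) ∧ PiecewiseC1 γ := by
  -- The set of reachable points is open and relatively closed in `Ω`, because reachability spreads
  -- through every ball in `Ω` along segments.
  let S : Set ℂ := {z | z ∈ Ω ∧ ∃ γ : Path a z, (∀ s, γ s ∈ Ω) ∧ PiecewiseC1 γ}
  have hext : ∀ x r, Metric.ball x r ⊆ Ω → ∀ y ∈ Metric.ball x r, ∀ z ∈ Metric.ball x r,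
      y ∈ S → z ∈ S := by
    rintro x r hsub y hy z hz ⟨-, γ, hγ, hγ'⟩
    refine ⟨hsub hz, γ.trans (Path.segment y z), fun s => ?_, hγ'.trans_segment z⟩
    have hs : (γ.trans (Path.segment y z)) s ∈ range (γ.trans (Path.segment y z)) := mem_range_self s
    rw [Path.trans_range, Path.range_segment] at hs
    rcases hs with ⟨s', hs'⟩ | hs
    · exact hs' ▸ hγ s'
    · exact hsub ((convex_ball x r).segment_subset hy hz hs)
  have haS : a ∈ S := by
    refine ⟨ha, Path.refl a, fun s => ha, 1, fun m => m, Nat.mono_cast, by simp, by simp, ?_⟩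
    intro m _
    rw [Path.refl_extend]
    exact contDiffOn_const
  have hopen : IsOpen S := by
    refine Metric.isOpen_iff.2 fun z hz => ?_
    obtain ⟨r, hr, hsub⟩ := Metric.isOpen_iff.1 hΩ z hz.1
    exact ⟨r, hr, fun y hy => hext z r hsub z (Metric.mem_ball_self hr) y hy hz⟩
  refine (hΩc.subset_of_closure_inter_subset hopen ⟨a, ha, haS⟩ ?_ hb).2
  rintro z ⟨hzS, hz⟩
  obtain ⟨r, hr, hsub⟩ := Metric.isOpen_iff.1 hΩ z hz
  obtain ⟨y, hy, hyz⟩ := Metric.mem_closure_iff.1 hzS r hr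
  exact hext z r hsub y (by rwa [Metric.mem_ball, dist_comm]) z (Metric.mem_ball_self hr) hy

end CPN

/-! ### Linear algebra of frames -/

section Frames

variable {V W F : Type*} [NormedAddCommGroup V] [InnerProductSpace ℝ V] [FiniteDimensional ℝ V]
  [NormedAddCommGroup F] [InnerProductSpace ℝ F]
  [AddCommGroup W] [Module ℝ W]

theorem inner_map_map_of_norm_eq {p q : W →ₗ[ℝ] F} (h : ∀ x, ‖p x‖ = ‖q x‖) (x y : W) :
    inner ℝ (p x) (p y) = inner ℝ (q x) (q y) := by
  rw [real_inner_eq_norm_add_mul_self_sub_norm_mul_self_sub_norm_mul_self_div_two,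
    real_inner_eq_norm_add_mul_self_sub_norm_mul_self_sub_norm_mul_self_div_two,
    ← map_add, ← map_add, h, h, h]

variable [FiniteDimensional ℝ F]

/-- Two linear maps to a Euclidean space with the same Gram form differ by an isometry. -/
theorem exists_linearIsometryEquiv_comp_eq {p q : W →ₗ[ℝ] F} (h : ∀ x, ‖p x‖ = ‖q x‖) :
    ∃ T : F ≃ₗᵢ[ℝ] F, ∀ x, T (p x) = q x := by
  -- Equal norms make `q` factor through the range of `p` by an isometric embedding, which extends
  -- to the whole space in finite dimension.
  have hker : LinearMap.ker p ≤ LinearMap.ker q := fun x hx => by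
    rw [LinearMap.mem_ker] at hx ⊢
    rw [← norm_eq_zero, ← h, hx, norm_zero]
  let L₀ : LinearMap.range p →ₗ[ℝ] F :=
    (LinearMap.ker p).liftQ q hker ∘ₗ p.quotKerEquivRange.symm.toLinearMap
  have hL₀ : ∀ x, L₀ ⟨p x, LinearMap.mem_range_self p x⟩ = q x := fun x => by
    have h1 : p.quotKerEquivRange.symm ⟨p x, LinearMap.mem_range_self p x⟩ =
        Submodule.Quotient.mk x := by
      rw [LinearEquiv.symm_apply_eq]
      rfl
    change (LinearMap.ker p).liftQ q hker (p.quotKerEquivRange.symm _) = q x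
    rw [h1]
    rfl
  let L : LinearMap.range p →ₗᵢ[ℝ] F := ⟨L₀, by
    rintro ⟨_, x, rfl⟩
    exact (congrArg norm (hL₀ x)).trans (h x).symm⟩
  refine ⟨L.extend.toLinearIsometryEquiv rfl, fun x => ?_⟩
  have h2 := L.extend_apply ⟨p x, LinearMap.mem_range_self p x⟩
  exact h2.trans (hL₀ x)

open ContinuousLinearMap in
/-- The Moore–Penrose inverse `(A† A)⁻¹ A†` of a linear map. -/
def pinv (A : V →L[ℝ] F) : F →L[ℝ] V := (adjoint A ∘L A).inverse ∘L adjoint A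

open ContinuousLinearMap in
theorem isInvertible_adjoint_comp_self {A : V →L[ℝ] F} (hA : Function.Injective A) :
    (adjoint A ∘L A).IsInvertible := by
  have hinj : Function.Injective (adjoint A ∘L A : V →L[ℝ] V).toLinearMap := by
    rw [← LinearMap.ker_eq_bot, LinearMap.ker_eq_bot']
    intro x hx
    have h1 : inner ℝ (A x) (A x) = 0 := by
      rw [← adjoint_inner_left]
      have h2 : adjoint A (A x) = 0 := hx
      rw [h2, inner_zero_left]
    exact hA ((inner_self_eq_zero.1 h1).trans (map_zero A).symm)
  exact ⟨(LinearEquiv.ofInjectiveEndo _ hinj).toContinuousLinearEquiv, by ext; rfl⟩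

open ContinuousLinearMap in
theorem pinv_apply_map {A : V →L[ℝ] F} (hA : Function.Injective A) (x : V) : pinv A (A x) = x := by
  have h := (isInvertible_adjoint_comp_self hA).inverse_apply_eq (x := x) (y := adjoint A (A x))
  exact h.2 rfl

open ContinuousLinearMap in
-- The normal equation `A† A (pinv A y) = A† y` makes the residual orthogonal to the range, so `A ∘
-- pinv A` is the orthogonal projection onto it.
theorem inner_map_sub_pinv {A : V →L[ℝ] F} (hA : Function.Injective A) (x : V) (y : F) :
    inner ℝ (A x) (y - A (pinv A y)) = 0 := by
  have h : adjoint A (A (pinv A y)) = adjoint A y :=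
    ((isInvertible_adjoint_comp_self hA).inverse_apply_eq.1 (rfl : pinv A y = pinv A y)).symm
  rw [← adjoint_inner_right, map_sub, h, sub_self, inner_zero_right]

/-- The components along two frames with the same Gram matrix agree if the inner products with
the frames do. -/
theorem pinv_eq_pinv {A B : V →L[ℝ] F} (hA : Function.Injective A)
    (hAB : ∀ v w, inner ℝ (A v) (A w) = inner ℝ (B v) (B w)) {x y : F}
    (h : ∀ v, inner ℝ (A v) x = inner ℝ (B v) y) : pinv A x = pinv B y := by
  have hB : Function.Injective B := by
    refine (injective_iff_map_eq_zero B).2 fun v hv => (injective_iff_map_eq_zero A).1 hA v ?_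
    rw [← inner_self_eq_zero (𝕜 := ℝ), hAB, hv, inner_zero_left]
  have h1 : ∀ v, inner ℝ (B v) (B (pinv A x)) = inner ℝ (B v) (B (pinv B y)) := fun v => by
    have h2 := inner_map_sub_pinv hA v x
    have h3 := inner_map_sub_pinv hB v y
    rw [inner_sub_right] at h2 h3
    rw [← hAB]
    linarith [h v]
  refine hB (sub_eq_zero.1 ((inner_self_eq_zero (𝕜 := ℝ)).1 ?_))
  rw [inner_sub_right, ← map_sub, h1, sub_self]

open ContinuousLinearMap in
-- The adjoint is bounded linear and inversion is smooth at invertible operators. This makes the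
-- tangential and normal projections of a `C²` immersion of class `C¹`.
theorem ContDiffOn.pinv {E : Type*} [NormedAddCommGroup E] [NormedSpace ℝ E] {n : WithTop ℕ∞}
    {U : Set E} {A : E → V →L[ℝ] F} (hA : ContDiffOn ℝ n A U)
    (hinj : ∀ z ∈ U, Function.Injective (A z)) : ContDiffOn ℝ n (fun z => pinv (A z)) U := by
  have hadj : ContDiffOn ℝ n (fun z => adjoint (A z)) U := by
    have h : IsBoundedLinearMap ℝ fun A : V →L[ℝ] F => adjoint A :=
      ⟨⟨map_add _, fun c A => by simp⟩, 1, one_pos, fun A => by simp⟩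
    exact h.contDiff.comp_contDiffOn hA
  intro z hz
  refine ContDiffWithinAt.clm_comp ?_ (hadj z hz)
  exact (isInvertible_adjoint_comp_self (hinj z hz)).contDiffAt_map_inverse.comp_contDiffWithinAt
    (f := fun z => adjoint (A z) ∘L A z) z ((hadj z hz).clm_comp (hA z hz))

end Frames

/-! ### Uniqueness for linear total differential equations -/

section Parallel

variable {V F : Type*} [NormedAddCommGroup V] [NormedSpace ℝ V]
  [NormedAddCommGroup F] [NormedSpace ℝ F]

/-- A function on a connected open set whose derivative is locally bounded by a multiple of the
function vanishes identically if it vanishes at a point. -/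
theorem eq_zero_of_fderiv_le {U : Set V} (hU : IsOpen U) (hUc : IsPreconnected U)
    {E : V → F} {E' : V → V →L[ℝ] F} (hE : ∀ z ∈ U, HasFDerivAt E (E' z) z)
    (hbound : ∀ z ∈ U, ∃ K : ℝ, ∀ᶠ y in 𝓝 z, ‖E' y‖ ≤ K * ‖E y‖) {z₀ : V} (hz₀ : z₀ ∈ U)
    (h0 : E z₀ = 0) : ∀ z ∈ U, E z = 0 := by
  let S : Set V := {z | z ∈ U ∧ E z = 0}
  have hopen : IsOpen S := by
    refine Metric.isOpen_iff.2 fun z hz => ?_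
    obtain ⟨K, hK⟩ := hbound z hz.1
    obtain ⟨r, hr, hsub⟩ := Metric.eventually_nhds_iff_ball.1 (hK.and (hU.mem_nhds hz.1))
    refine ⟨r, hr, fun y hy => ⟨(hsub y hy).2, ?_⟩⟩
    have hmem : ∀ t ∈ Icc (0 : ℝ) 1, z + t • (y - z) ∈ Metric.ball z r := fun t ht =>
      (convex_ball z r).add_smul_sub_mem (Metric.mem_ball_self hr) hy ht
    have hd : ∀ t ∈ Icc (0 : ℝ) 1, HasDerivAt (fun t : ℝ => E (z + t • (y - z)))
        (E' (z + t • (y - z)) (y - z)) t := fun t ht => by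
      have h1 : HasDerivAt (fun t : ℝ => z + t • (y - z)) (y - z) t := by
        simpa using ((hasDerivAt_id t).smul_const (y - z)).const_add z
      exact (hE _ (hsub _ (hmem t ht)).2).comp_hasDerivAt t h1
    -- Grönwall's inequality along the segment from `z` to `y`.
    have h2 := eq_zero_of_abs_deriv_le_mul_abs_self_of_eq_zero_right (K := K * ‖y - z‖)
      (fun t ht => (hd t ht).continuousAt.continuousWithinAt)
      (fun t ht => (hd t (Ico_subset_Icc_self ht)).hasDerivWithinAt) (by simpa using hz.2)
      (fun t ht => by
        have h3 := (hsub _ (hmem t (Ico_subset_Icc_self ht))).1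
        refine (ContinuousLinearMap.le_opNorm _ _).trans ?_
        calc _ ≤ (K * ‖E (z + t • (y - z))‖) * ‖y - z‖ := by gcongr
          _ = _ := by ring) 1 (by simp)
    simpa using h2
  refine fun z hz => (hUc.subset_of_closure_inter_subset hopen ⟨z₀, hz₀, hz₀, h0⟩ ?_ hz).2
  rintro y ⟨hyS, hyU⟩
  refine ⟨hyU, ?_⟩
  have hy := mem_closure_iff_frequently.1 hyS
  by_contra hne
  exact hy (((hE y hyU).continuousAt.eventually_ne hne).mono fun w hw hwS => hw hwS.2)

/-- A `1`-form that is parallel for a linear connection on a connected open set vanishes if it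
vanishes at a point. -/
theorem eq_zero_of_parallel {U : Set V} (hU : IsOpen U) (hUc : IsPreconnected U)
    {Γ : V → V →L[ℝ] V →L[ℝ] V} (hΓ : ContinuousOn Γ U) {E : V → V →L[ℝ] F}
    {E' : V → V →L[ℝ] V →L[ℝ] F} (hE : ∀ z ∈ U, HasFDerivAt E (E' z) z)
    (hpar : ∀ z ∈ U, ∀ v w, E' z v w = E z (Γ z v w)) {z₀ : V} (hz₀ : z₀ ∈ U)
    (h0 : E z₀ = 0) : ∀ z ∈ U, E z = 0 := by
  refine eq_zero_of_fderiv_le hU hUc hE (fun z hz => ?_) hz₀ h0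
  -- By continuity of `Γ`, this bounds `‖Γ y‖` for `y` near `z`.
  refine ⟨‖Γ z‖ + 1, ?_⟩
  have hcont : ContinuousAt Γ z := hΓ.continuousAt (hU.mem_nhds hz)
  have hnorm : Tendsto (fun y => ‖Γ y‖) (𝓝 z) (𝓝 ‖Γ z‖) :=
    ContinuousAt.norm (E := V →L[ℝ] V →L[ℝ] V) hcont
  have h1 := hnorm.eventually_le_const (lt_add_one ‖Γ z‖)
  filter_upwards [h1, hU.mem_nhds hz] with y hy hyU
  refine ContinuousLinearMap.opNorm_le_bound _ (by positivity) fun v => ?_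
  refine ContinuousLinearMap.opNorm_le_bound _ (by positivity) fun w => ?_
  rw [hpar y hyU]
  calc _ ≤ ‖E y‖ * (‖Γ y‖ * ‖v‖ * ‖w‖) :=
        (ContinuousLinearMap.le_opNorm _ _).trans
          (by gcongr; exact ContinuousLinearMap.le_opNorm₂ _ _ _)
    _ ≤ ‖E y‖ * ((‖Γ z‖ + 1) * ‖v‖ * ‖w‖) := by gcongr
    _ = _ := by ring

end Parallel

/-! ### Maps with the same first fundamental form -/

section Koszul

variable {V F : Type*} [NormedAddCommGroup V] [NormedSpace ℝ V]
  [NormedAddCommGroup F] [InnerProductSpace ℝ F]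

theorem ContDiffOn.fderiv_one {U : Set V} (hU : IsOpen U) {X : V → F} (hX : ContDiffOn ℝ 2 X U) :
    ContDiffOn ℝ 1 (fderiv ℝ X) U :=
  hX.fderiv_of_isOpen hU (by norm_num)

theorem ContDiffOn.hasFDerivAt_fderiv {U : Set V} (hU : IsOpen U) {X : V → F}
    (hX : ContDiffOn ℝ 2 X U) {z : V} (hz : z ∈ U) :
    HasFDerivAt (fderiv ℝ X) (fderiv ℝ (fderiv ℝ X) z) z :=
  (((hX.fderiv_one hU).differentiableOn one_ne_zero).differentiableAt (hU.mem_nhds hz)).hasFDerivAt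

theorem ContDiffOn.fderiv_fderiv_comm {U : Set V} (hU : IsOpen U) {X : V → F}
    (hX : ContDiffOn ℝ 2 X U) {z : V} (hz : z ∈ U) (v w : V) :
    fderiv ℝ (fderiv ℝ X) z v w = fderiv ℝ (fderiv ℝ X) z w v :=
  ((hX.contDiffAt (hU.mem_nhds hz)).isSymmSndFDerivAt (by simp)).eq v w

/-- The Koszul formula: the tangential part of the second derivative depends on the first
fundamental form only. -/
theorem inner_fderiv_fderiv_eq_of_inner_fderiv_eq {U : Set V} (hU : IsOpen U) {X Y : V → F}
    (hX : ContDiffOn ℝ 2 X U) (hY : ContDiffOn ℝ 2 Y U)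
    (h : ∀ z ∈ U, ∀ v w, inner ℝ (fderiv ℝ X z v) (fderiv ℝ X z w) =
      inner ℝ (fderiv ℝ Y z v) (fderiv ℝ Y z w)) {z : V} (hz : z ∈ U) (u v w : V) :
    inner ℝ (fderiv ℝ X z w) (fderiv ℝ (fderiv ℝ X) z u v) =
      inner ℝ (fderiv ℝ Y z w) (fderiv ℝ (fderiv ℝ Y) z u v) := by
  have hder : ∀ {Z : V → F}, ContDiffOn ℝ 2 Z U → ∀ a b c,
      fderiv ℝ (fun y => inner ℝ (fderiv ℝ Z y a) (fderiv ℝ Z y b)) z c =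
        inner ℝ (fderiv ℝ Z z a) (fderiv ℝ (fderiv ℝ Z) z c b) +
          inner ℝ (fderiv ℝ (fderiv ℝ Z) z c a) (fderiv ℝ Z z b) := by
    intro Z hZ a b c
    have h1 := hZ.hasFDerivAt_fderiv hU hz
    have h2 := ((h1.clm_apply (hasFDerivAt_const a z)).inner ℝ
      (h1.clm_apply (hasFDerivAt_const b z))).fderiv
    rw [h2]
    simp
  have hsum : ∀ a b c,
      inner ℝ (fderiv ℝ X z a) (fderiv ℝ (fderiv ℝ X) z c b) +
          inner ℝ (fderiv ℝ X z b) (fderiv ℝ (fderiv ℝ X) z c a) =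
      inner ℝ (fderiv ℝ Y z a) (fderiv ℝ (fderiv ℝ Y) z c b) +
          inner ℝ (fderiv ℝ Y z b) (fderiv ℝ (fderiv ℝ Y) z c a) := by
    intro a b c
    have h1 : (fun y => inner ℝ (fderiv ℝ X y a) (fderiv ℝ X y b)) =ᶠ[𝓝 z]
        fun y => inner ℝ (fderiv ℝ Y y a) (fderiv ℝ Y y b) := by
      filter_upwards [hU.mem_nhds hz] with y hy using h y hy a b
    have h2 := hder hX a b c
    rw [h1.fderiv_eq, hder hY] at h2
    rw [real_inner_comm (fderiv ℝ (fderiv ℝ X) z c a), real_inner_comm (fderiv ℝ (fderiv ℝ Y) z c a)]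
    exact h2.symm
  -- Three permutations of the derivative of the metric; with the symmetry of second derivatives,
  -- `h1 + h2 - h3` isolates twice the wanted product.
  have h1 := hsum w v u
  have h2 := hsum w u v
  have h3 := hsum u v w
  rw [hX.fderiv_fderiv_comm hU hz v u, hY.fderiv_fderiv_comm hU hz v u] at h2
  rw [hX.fderiv_fderiv_comm hU hz w u, hY.fderiv_fderiv_comm hU hz w u,
    hX.fderiv_fderiv_comm hU hz w v, hY.fderiv_fderiv_comm hU hz w v] at h3
  linarith

end Koszul

namespace CPN

open Complex

variable {N : ℕ}

/-! ### Tangential and normal parts -/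

theorem mem_normalSpace {X : ℂ → Su N} {z : ℂ} {A : Su N} :
    A ∈ normalSpace X z ↔ ∀ v, inner ℝ (fderiv ℝ X z v) A = 0 := by
  rw [normalSpace, Submodule.mem_orthogonal]
  exact ⟨fun h v => h _ ⟨v, rfl⟩, by rintro h _ ⟨v, rfl⟩; exact h v⟩

theorem normalPart_mem (X : ℂ → Su N) (z : ℂ) (A : Su N) : normalPart X z A ∈ normalSpace X z :=
  Submodule.starProjection_apply_mem _ _

theorem secondForm_mem (X : ℂ → Su N) (z v w : ℂ) : secondForm X z v w ∈ normalSpace X z :=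
  normalPart_mem X z _

theorem normalPart_tangent_add {X : ℂ → Su N} {z : ℂ} {A : Su N} (hA : A ∈ normalSpace X z)
    (v : ℂ) : normalPart X z (fderiv ℝ X z v + A) = A := by
  refine Submodule.eq_starProjection_of_mem_of_inner_eq_zero hA fun w hw => ?_
  rw [add_sub_cancel_right]
  exact mem_normalSpace.1 hw v

/-- The Gram matrix annihilates the real coordinates of a kernel vector, and elimination multiplies
each coordinate by the determinant. -/
theorem injective_fderiv_of_metricDet_ne_zero {X : ℂ → Su N} {z : ℂ} (h : metricDet X z ≠ 0) :
    Function.Injective (fderiv ℝ X z) := by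
  refine (injective_iff_map_eq_zero _).2 fun v hv => ?_
  have hv' : v.re • fderiv ℝ X z 1 + v.im • fderiv ℝ X z I = 0 := by
    rw [← map_smul, ← map_smul, ← map_add, ← hv]
    congr 1
    apply Complex.ext <;> simp
  have h1 : v.re * firstForm X z 1 1 + v.im * firstForm X z 1 I = 0 := by
    have h2 := congrArg (inner ℝ (fderiv ℝ X z 1)) hv'
    rwa [inner_add_right, inner_smul_right, inner_smul_right, inner_zero_right] at h2
  have h2 : v.re * firstForm X z 1 I + v.im * firstForm X z I I = 0 := by
    have h2 := congrArg (inner ℝ (fderiv ℝ X z I)) hv'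
    rw [inner_add_right, inner_smul_right, inner_smul_right, inner_zero_right,
      real_inner_comm] at h2
    exact h2
  apply Complex.ext
  · refine (mul_eq_zero.1 (?_ : metricDet X z * v.re = 0)).resolve_left h
    rw [metricDet]
    linear_combination firstForm X z I I * h1 - firstForm X z 1 I * h2
  · refine (mul_eq_zero.1 (?_ : metricDet X z * v.im = 0)).resolve_left h
    rw [metricDet]
    linear_combination firstForm X z 1 1 * h2 - firstForm X z 1 I * h1

theorem injective_fderiv_of_firstForm_eq {X Y : ℂ → Su N} {z : ℂ}
    (h : ∀ v w, firstForm Y z v w = firstForm X z v w)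
    (hX : Function.Injective (fderiv ℝ X z)) : Function.Injective (fderiv ℝ Y z) := by
  refine (injective_iff_map_eq_zero _).2 fun v hv => (injective_iff_map_eq_zero _).1 hX v ?_
  have h1 := h v v
  rw [firstForm, firstForm, hv, inner_zero_left] at h1
  exact inner_self_eq_zero.1 h1.symm

/-- The splitting of a vector into its tangential and normal parts. -/
theorem tangent_add_normalPart {X : ℂ → Su N} {z : ℂ} (hX : Function.Injective (fderiv ℝ X z))
    (A : Su N) : fderiv ℝ X z (pinv (fderiv ℝ X z) A) + normalPart X z A = A := by
  have h1 : A - fderiv ℝ X z (pinv (fderiv ℝ X z) A) ∈ normalSpace X z :=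
    mem_normalSpace.2 fun v => inner_map_sub_pinv hX v A
  have h2 := normalPart_tangent_add h1 (pinv (fderiv ℝ X z) A)
  rw [add_sub_cancel] at h2
  rw [h2, add_sub_cancel]

/-- The Gauss formula. -/
theorem tangent_add_secondForm {X : ℂ → Su N} {z : ℂ} (hX : Function.Injective (fderiv ℝ X z))
    (v w : ℂ) : fderiv ℝ X z (pinv (fderiv ℝ X z) (fderiv ℝ (fderiv ℝ X) z v w)) +
      secondForm X z v w = fderiv ℝ (fderiv ℝ X) z v w :=
  tangent_add_normalPart hX _

/-- Maps with the same first fundamental form have the same Christoffel symbols. -/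
theorem pinv_fderiv_fderiv_eq {U : Set ℂ} (hU : IsOpen U) {X Y : ℂ → Su N}
    (hX : ContDiffOn ℝ 2 X U) (hY : ContDiffOn ℝ 2 Y U)
    (h : ∀ z ∈ U, ∀ v w, firstForm Y z v w = firstForm X z v w)
    (hinj : ∀ z ∈ U, Function.Injective (fderiv ℝ X z)) {z : ℂ} (hz : z ∈ U) (v w : ℂ) :
    pinv (fderiv ℝ Y z) (fderiv ℝ (fderiv ℝ Y) z v w) =
      pinv (fderiv ℝ X z) (fderiv ℝ (fderiv ℝ X) z v w) :=
  (pinv_eq_pinv (hinj z hz) (fun a b => (h z hz a b).symm) fun u =>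
    inner_fderiv_fderiv_eq_of_inner_fderiv_eq hU hX hY (fun z hz a b => (h z hz a b).symm)
      hz v w u).symm

/-! ### Euclidean motions -/

/-- Maps whose derivatives differ by a constant isometry are congruent. -/
theorem congruent_of_fderiv_eq {U : Set ℂ} (hU : IsOpen U) (hUc : IsPreconnected U)
    {X Y : ℂ → Su N} (hX : DifferentiableOn ℝ X U) (hY : DifferentiableOn ℝ Y U)
    (L : Su N ≃ₗᵢ[ℝ] Su N) (h : ∀ z ∈ U, ∀ v, fderiv ℝ Y z v = L (fderiv ℝ X z v)) :
    Congruent U X Y := by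
  have hLX : ∀ z ∈ U, HasFDerivAt (fun z => L (X z))
      ((L.toContinuousLinearEquiv : Su N →L[ℝ] Su N) ∘L fderiv ℝ X z) z := fun z hz =>
    (L.toContinuousLinearEquiv : Su N →L[ℝ] Su N).hasFDerivAt.comp z
      (hX.differentiableAt (hU.mem_nhds hz)).hasFDerivAt
  obtain ⟨c, hc⟩ := hU.exists_eq_add_of_fderiv_eq (𝕜 := ℝ) hUc hY
    (fun z hz => (hLX z hz).differentiableAt.differentiableWithinAt)
    (fun z hz => by
      rw [(hLX z hz).fderiv]
      ext v
      exact h z hz v)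
  refine ⟨L.toAffineIsometryEquiv.trans (AffineIsometryEquiv.constVAdd ℝ (Su N) c), fun z hz => ?_⟩
  rw [hc hz]
  simp [add_comm]

theorem Congruent.exists_eq_add {U : Set ℂ} {X Y : ℂ → Su N} (h : Congruent U X Y) :
    ∃ (L : Su N ≃ₗᵢ[ℝ] Su N) (c : Su N), ∀ z ∈ U, Y z = L (X z) + c := by
  obtain ⟨M, hM⟩ := h
  refine ⟨M.linearIsometryEquiv, M 0, fun z hz => ?_⟩
  rw [hM z hz]
  simpa using M.map_vadd 0 (X z)

section Motion

variable {U : Set ℂ} {X Y : ℂ → Su N} {L : Su N ≃ₗᵢ[ℝ] Su N} {c : Su N}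

theorem fderiv_eq_of_eq_add (hU : IsOpen U) (h : ∀ z ∈ U, Y z = L (X z) + c) {z : ℂ}
    (hz : z ∈ U) :
    fderiv ℝ Y z = (L.toContinuousLinearEquiv : Su N →L[ℝ] Su N) ∘L fderiv ℝ X z := by
  have h1 : Y =ᶠ[𝓝 z] fun z => L.toContinuousLinearEquiv (X z) + c := by
    filter_upwards [hU.mem_nhds hz] with y hy using h y hy
  rw [h1.fderiv_eq, fderiv_add_const]
  exact L.toContinuousLinearEquiv.comp_fderiv

theorem fderiv_fderiv_eq_of_eq_add (hU : IsOpen U) (h : ∀ z ∈ U, Y z = L (X z) + c)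
    (hX : ContDiffOn ℝ 2 X U) {z : ℂ} (hz : z ∈ U) (v w : ℂ) :
    fderiv ℝ (fderiv ℝ Y) z v w = L (fderiv ℝ (fderiv ℝ X) z v w) := by
  have h1 : fderiv ℝ Y =ᶠ[𝓝 z]
      fun z => (L.toContinuousLinearEquiv : Su N →L[ℝ] Su N) ∘L fderiv ℝ X z := by
    filter_upwards [hU.mem_nhds hz] with y hy using fderiv_eq_of_eq_add hU h hy
  rw [h1.fderiv_eq, ((hasFDerivAt_const _ z).clm_comp (hX.hasFDerivAt_fderiv hU hz)).fderiv]
  simp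

theorem map_mem_normalSpace_iff (hU : IsOpen U) (h : ∀ z ∈ U, Y z = L (X z) + c) {z : ℂ}
    (hz : z ∈ U) {A : Su N} : L A ∈ normalSpace Y z ↔ A ∈ normalSpace X z := by
  simp [mem_normalSpace, fderiv_eq_of_eq_add hU h hz]

/-- The linear part of a motion carries the splitting into tangential and normal parts along `X` to
that along `Y`, and the splitting is unique. -/
theorem normalPart_map (hU : IsOpen U) (h : ∀ z ∈ U, Y z = L (X z) + c) {z : ℂ}
    (hz : z ∈ U) (hX : Function.Injective (fderiv ℝ X z)) (A : Su N) :
    normalPart Y z (L A) = L (normalPart X z A) := by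
  have h1 := normalPart_tangent_add
    ((map_mem_normalSpace_iff hU h hz).2 (normalPart_mem X z A)) (pinv (fderiv ℝ X z) A)
  rw [← h1]
  congr 1
  conv_lhs => rw [← tangent_add_normalPart hX A]
  simp [fderiv_eq_of_eq_add hU h hz]

theorem firstForm_eq_of_eq_add (hU : IsOpen U) (h : ∀ z ∈ U, Y z = L (X z) + c) {z : ℂ}
    (hz : z ∈ U) (v w : ℂ) : firstForm Y z v w = firstForm X z v w := by
  simp [firstForm, fderiv_eq_of_eq_add hU h hz]

theorem secondForm_eq_of_eq_add (hU : IsOpen U) (h : ∀ z ∈ U, Y z = L (X z) + c)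
    (hX : ContDiffOn ℝ 2 X U) {z : ℂ} (hz : z ∈ U) (hinj : Function.Injective (fderiv ℝ X z))
    (v w : ℂ) : secondForm Y z v w = L (secondForm X z v w) := by
  rw [secondForm, secondForm, fderiv_fderiv_eq_of_eq_add hU h hX hz, normalPart_map hU h hz hinj]

/-- A constant linear map commutes with differentiation, and `L` also commutes with the normal
projections. This is the easy direction of (ii). -/
theorem isNormalIsometry_of_eq_add (hU : IsOpen U) (h : ∀ z ∈ U, Y z = L (X z) + c)
    (hinj : ∀ z ∈ U, Function.Injective (fderiv ℝ X z)) :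
    IsNormalIsometry U X Y fun _ => L.toLinearEquiv.toLinearMap where
  bijOn z hz := by
    refine ⟨fun A hA => (map_mem_normalSpace_iff hU h hz).2 hA, L.injective.injOn, fun A hA => ?_⟩
    refine ⟨L.symm A, (map_mem_normalSpace_iff hU h hz).1 ?_, L.apply_symm_apply A⟩
    rwa [L.apply_symm_apply]
  norm_map z _ A _ := L.norm_map A
  isNormalField η hη := ⟨L.toContinuousLinearEquiv.contDiff.comp_contDiffOn hη.1,
    fun z hz => (map_mem_normalSpace_iff hU h hz).2 (hη.2 z hz)⟩
  parallel η hη z hz v := by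
    have h1 : fderiv ℝ (fun ζ => L.toContinuousLinearEquiv (η ζ)) z =
        (L.toContinuousLinearEquiv : Su N →L[ℝ] Su N) ∘L fderiv ℝ η z :=
      L.toContinuousLinearEquiv.comp_fderiv
    change normalPart Y z (fderiv ℝ (fun ζ => L.toContinuousLinearEquiv (η ζ)) z v) =
      L (normalPart X z (fderiv ℝ η z v))
    rw [h1, ← normalPart_map hU h hz (hinj z hz)]
    rfl

end Motion

end CPN

namespace CPN

open Complex

variable {N : ℕ}

/-! ### Rigidity -/

section Rigidity

variable {U : Set ℂ} {X Y : ℂ → Su N}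

/-- The Levi-Civita connection of an immersion. -/
def christoffel (X : ℂ → Su N) (z : ℂ) : ℂ →L[ℝ] ℂ →L[ℝ] ℂ :=
  (ContinuousLinearMap.compL ℝ ℂ (Su N) ℂ (pinv (fderiv ℝ X z))) ∘L fderiv ℝ (fderiv ℝ X) z

theorem continuousOn_christoffel (hU : IsOpen U) (hX : ContDiffOn ℝ 2 X U)
    (hinj : ∀ z ∈ U, Function.Injective (fderiv ℝ X z)) : ContinuousOn (christoffel X) U := by
  have h1 : ContinuousOn (fun z => pinv (fderiv ℝ X z)) U :=
    ((hX.fderiv_one hU).pinv hinj).continuousOn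
  have h2 : ContinuousOn (fderiv ℝ (fderiv ℝ X)) U :=
    (hX.fderiv_one hU).continuousOn_fderiv_of_isOpen hU le_rfl
  exact ((ContinuousLinearMap.compL ℝ ℂ (Su N) ℂ).continuous.comp_continuousOn h1).clm_comp h2

/-- The Gauss formula for `X` and for a map `Y` with the same first fundamental form. -/
theorem fderiv_fderiv_eq_christoffel_add (hU : IsOpen U) (hX : ContDiffOn ℝ 2 X U)
    (hY : ContDiffOn ℝ 2 Y U) (hinj : ∀ z ∈ U, Function.Injective (fderiv ℝ X z))
    (hI : ∀ z ∈ U, ∀ v w, firstForm Y z v w = firstForm X z v w) {z : ℂ} (hz : z ∈ U) (v w : ℂ) :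
    fderiv ℝ (fderiv ℝ Y) z v w = fderiv ℝ Y z (christoffel X z v w) + secondForm Y z v w := by
  rw [← tangent_add_secondForm (injective_fderiv_of_firstForm_eq (hI z hz) (hinj z hz)) v w,
    pinv_fderiv_fderiv_eq hU hX hY hI hinj hz]
  rfl

/-- Immersions with the same first fundamental form whose second fundamental forms differ by a
constant isometry are congruent. The difference of the derivatives is then parallel, so that it
spans a fixed subspace, to which the second fundamental forms are orthogonal. -/
theorem congruent_of_secondForm_eq_map (hU : IsOpen U) (hUc : IsConnected U)
    (hX : ContDiffOn ℝ 2 X U) (hY : ContDiffOn ℝ 2 Y U)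
    (hinj : ∀ z ∈ U, Function.Injective (fderiv ℝ X z))
    (hI : ∀ z ∈ U, ∀ v w, firstForm Y z v w = firstForm X z v w) (R : Su N ≃ₗᵢ[ℝ] Su N)
    (hII : ∀ z ∈ U, ∀ v w, secondForm Y z v w = R (secondForm X z v w)) : Congruent U X Y := by
  obtain ⟨z₀, hz₀⟩ := hUc.nonempty
  have hΓ := continuousOn_christoffel hU hX hinj
  have hGX : ∀ {z}, z ∈ U → ∀ v w, fderiv ℝ (fderiv ℝ X) z v w =
      fderiv ℝ X z (christoffel X z v w) + secondForm X z v w := fun hz v w =>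
    fderiv_fderiv_eq_christoffel_add hU hX hX hinj (fun _ _ _ _ => rfl) hz v w
  have hGY : ∀ {z}, z ∈ U → ∀ v w, fderiv ℝ (fderiv ℝ Y) z v w =
      fderiv ℝ Y z (christoffel X z v w) + secondForm Y z v w := fun hz v w =>
    fderiv_fderiv_eq_christoffel_add hU hX hY hinj hI hz v w
  let D : ℂ → ℂ → Su N := fun z v => R (fderiv ℝ X z v) - fderiv ℝ Y z v
  -- Used twice: with `S = R` and `Q` the pairing with a fixed vector, and at the end with `S = T ∘
  -- R` and `Q` the identity.
  have hDer : ∀ (S : Su N →L[ℝ] Su N) (G : Type) [NormedAddCommGroup G] [NormedSpace ℝ G]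
      (Q : Su N →L[ℝ] G), ∀ z ∈ U,
      HasFDerivAt (fun z => Q ∘L (S ∘L fderiv ℝ X z - fderiv ℝ Y z))
        ((ContinuousLinearMap.compL ℝ ℂ (Su N) G Q) ∘L
          ((ContinuousLinearMap.compL ℝ ℂ (Su N) (Su N) S) ∘L fderiv ℝ (fderiv ℝ X) z -
            fderiv ℝ (fderiv ℝ Y) z)) z := by
    intro S G _ _ Q z hz
    exact (ContinuousLinearMap.compL ℝ ℂ (Su N) G Q).hasFDerivAt.comp z
      (((ContinuousLinearMap.compL ℝ ℂ (Su N) (Su N) S).hasFDerivAt.comp z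
        (hX.hasFDerivAt_fderiv hU hz)).sub (hY.hasFDerivAt_fderiv hU hz))
  have hDconst : ∀ e : Su N, ∀ z ∈ U, (∀ v, inner ℝ e (D z v) = 0) →
      ∀ y ∈ U, ∀ v, inner ℝ e (D y v) = 0 := by
    intro e z hz h y hy v
    have h1 := eq_zero_of_parallel hU hUc.isPreconnected hΓ
      (hDer (R.toContinuousLinearEquiv : Su N →L[ℝ] Su N) ℝ (innerSL ℝ e))
      (fun x hx v w => by
        simp [hGX hx, hGY hx, hII x hx, inner_add_right]) hz
      (by ext v; exact h v) y hy
    exact congrArg (fun B : ℂ →L[ℝ] ℝ => B v) h1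
  -- The orthogonal complement of the image of `D z₀`; by `hDconst` every point of `U` gives the
  -- same space.
  let K : Submodule ℝ (Su N) :=
    { carrier := {e | ∀ v, inner ℝ e (D z₀ v) = 0}
      add_mem' := fun ha hb v => by rw [inner_add_left, ha v, hb v, add_zero]
      zero_mem' := fun v => inner_zero_left _
      smul_mem' := fun c a ha v => by rw [inner_smul_left, ha v, mul_zero] }
  let p : ℂ × K →ₗ[ℝ] Su N :=
    (R.toLinearEquiv.toLinearMap ∘ₗ (fderiv ℝ X z₀).toLinearMap).coprod K.subtype
  let q : ℂ × K →ₗ[ℝ] Su N := (fderiv ℝ Y z₀).toLinearMap.coprod K.subtype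
  have hp : ∀ v (e : K), p (v, e) = R (fderiv ℝ X z₀ v) + e := fun v e => rfl
  have hq : ∀ v (e : K), q (v, e) = fderiv ℝ Y z₀ v + e := fun v e => rfl
  -- The tangential squares agree by equality of the first fundamental forms, the mixed terms by
  -- definition of `K`.
  obtain ⟨T, hT⟩ := exists_linearIsometryEquiv_comp_eq (p := p) (q := q) (by
    rintro ⟨v, e⟩
    rw [← sq_eq_sq₀ (norm_nonneg _) (norm_nonneg _), hp, hq, norm_add_sq_real, norm_add_sq_real,
      R.norm_map, ← real_inner_self_eq_norm_sq (fderiv ℝ X z₀ v),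
      ← real_inner_self_eq_norm_sq (fderiv ℝ Y z₀ v)]
    have h1 := hI z₀ hz₀ v v
    have h2 : inner ℝ (e : Su N) (R (fderiv ℝ X z₀ v) - fderiv ℝ Y z₀ v) = 0 := e.2 v
    rw [inner_sub_right, real_inner_comm, real_inner_comm (fderiv ℝ Y z₀ v)] at h2
    rw [firstForm, firstForm] at h1
    linarith)
  have hTX : ∀ v, T (R (fderiv ℝ X z₀ v)) = fderiv ℝ Y z₀ v := fun v => by
    simpa [hp, hq] using hT (v, 0)
  have hTK : ∀ e ∈ K, T e = e := fun e he => by simpa [hp, hq] using hT (0, ⟨e, he⟩)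
  -- The vector is normal to `dY`, and, being `R II_X`, also to `R dX`.
  have hIIK : ∀ z ∈ U, ∀ v w, secondForm Y z v w ∈ K := fun z hz v w => by
    refine hDconst _ z hz (fun u => ?_) z₀ hz₀
    rw [inner_sub_right, real_inner_comm (fderiv ℝ Y z u),
      mem_normalSpace.1 (secondForm_mem Y z v w) u, hII z hz, R.inner_map_map, real_inner_comm,
      mem_normalSpace.1 (secondForm_mem X z v w) u, sub_zero]
  refine congruent_of_fderiv_eq hU hUc.isPreconnected (hX.differentiableOn two_ne_zero)
    (hY.differentiableOn two_ne_zero) (R.trans T) fun z hz v => ?_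
  -- `T` fixes `R II_X = II_Y`, so the normal terms cancel again; this time the difference vanishes
  -- at `z₀`.
  have h1 := eq_zero_of_parallel hU hUc.isPreconnected hΓ
    (hDer ((R.trans T).toContinuousLinearEquiv : Su N →L[ℝ] Su N) (Su N)
      (ContinuousLinearMap.id ℝ (Su N)))
    (fun x hx v w => by
      have h2 := hTK _ (hIIK x hx v w)
      rw [hII x hx] at h2
      simp [hGX hx, hGY hx, hII x hx, h2]) hz₀
    (by ext v : 1; simp [hTX]) z hz
  have h2 := congrArg (fun B : ℂ →L[ℝ] Su N => B v) h1
  exact (sub_eq_zero.1 h2).symm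

/-- Immersions with the same first fundamental form and corresponding second fundamental forms and
normal connections are congruent. The isometry that carries the frame and the normal spaces of `X`
to those of `Y` does not depend on the point. -/
theorem congruent_of_isNormalIsometry (hU : IsOpen U) (hUc : IsConnected U)
    (hX : ContDiffOn ℝ 2 X U) (hY : ContDiffOn ℝ 2 Y U)
    (hinj : ∀ z ∈ U, Function.Injective (fderiv ℝ X z))
    (hI : ∀ z ∈ U, ∀ v w, firstForm Y z v w = firstForm X z v w) {Φ : ℂ → Su N →ₗ[ℝ] Su N}
    (hΦ : IsNormalIsometry U X Y Φ)
    (hII : ∀ z ∈ U, ∀ v w, secondForm Y z v w = Φ z (secondForm X z v w)) :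
    Congruent U X Y := by
  obtain ⟨z₀, hz₀⟩ := hUc.nonempty
  have hinjY : ∀ z ∈ U, Function.Injective (fderiv ℝ Y z) := fun z hz =>
    injective_fderiv_of_firstForm_eq (hI z hz) (hinj z hz)
  have hGX : ∀ {z}, z ∈ U → ∀ v w, fderiv ℝ (fderiv ℝ X) z v w =
      fderiv ℝ X z (christoffel X z v w) + secondForm X z v w := fun hz v w =>
    fderiv_fderiv_eq_christoffel_add hU hX hX hinj (fun _ _ _ _ => rfl) hz v w
  have hGY : ∀ {z}, z ∈ U → ∀ v w, fderiv ℝ (fderiv ℝ Y) z v w =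
      fderiv ℝ Y z (christoffel X z v w) + secondForm Y z v w := fun hz v w =>
    fderiv_fderiv_eq_christoffel_add hU hX hY hinj hI hz v w
  have hΦinner : ∀ z ∈ U, ∀ a ∈ normalSpace X z, ∀ b ∈ normalSpace X z,
      inner ℝ (Φ z a) (Φ z b) = inner ℝ a b := fun z hz a ha b hb =>
    inner_map_map_of_norm_eq (p := Φ z ∘ₗ (normalSpace X z).subtype)
      (q := (normalSpace X z).subtype) (fun x => hΦ.norm_map z hz x x.2) ⟨a, ha⟩ ⟨b, hb⟩
  -- the isometry at a point
  let S : ℂ → Su N →ₗ[ℝ] Su N := fun z =>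
    (fderiv ℝ Y z).toLinearMap ∘ₗ (pinv (fderiv ℝ X z)).toLinearMap +
      Φ z ∘ₗ (normalSpace X z).starProjection.toLinearMap
  have hS : ∀ z A, S z A = fderiv ℝ Y z (pinv (fderiv ℝ X z) A) + Φ z (normalPart X z A) :=
    fun z A => rfl
  have hSt : ∀ z ∈ U, ∀ v, S z (fderiv ℝ X z v) = fderiv ℝ Y z v := fun z hz v => by
    have h1 := normalPart_tangent_add (Submodule.zero_mem (normalSpace X z)) v
    rw [add_zero] at h1
    rw [hS, pinv_apply_map (hinj z hz), h1, map_zero, add_zero]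
  have hSn : ∀ z ∈ U, ∀ a ∈ normalSpace X z, S z a = Φ z a := fun z hz a ha => by
    have h1 := normalPart_tangent_add ha 0
    rw [map_zero, zero_add] at h1
    have h2 := tangent_add_normalPart (hinj z hz) a
    rw [h1, add_eq_right] at h2
    rw [hS, h1, hinj z hz (h2.trans (map_zero _).symm), map_zero, zero_add]
  have hSnorm : ∀ z ∈ U, ∀ A, ‖S z A‖ = ‖A‖ := fun z hz A => by
    have h1 : ∀ {Z : ℂ → Su N} {v : ℂ} {a : Su N}, a ∈ normalSpace Z z →
        ‖fderiv ℝ Z z v + a‖ ^ 2 = ‖fderiv ℝ Z z v‖ ^ 2 + ‖a‖ ^ 2 := fun ha => by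
      rw [norm_add_sq_real, mem_normalSpace.1 ha, mul_zero, add_zero]
    rw [← sq_eq_sq₀ (norm_nonneg _) (norm_nonneg _), hS,
      h1 ((hΦ.bijOn z hz).mapsTo (normalPart_mem X z A)), hΦ.norm_map z hz _ (normalPart_mem X z A),
      ← real_inner_self_eq_norm_sq]
    conv_rhs => rw [← tangent_add_normalPart (hinj z hz) A, h1 (normalPart_mem X z A),
      ← real_inner_self_eq_norm_sq]
    rw [← firstForm, ← firstForm, hI z hz]
  -- Split the fixed vector as `A = dX(k) + η`, so that `S A = dY(k) + Φ η`. Differentiating both,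
  -- the Gauss formulas with the common `Γ` and `hSη` show that the derivative of `S A` is `S`
  -- applied to the derivative of the constant `A`.
  have hSconst : ∀ A, ∀ z ∈ U, S z A = S z₀ A := by
    intro A z hz
    let k : ℂ → ℂ := fun z => pinv (fderiv ℝ X z) A
    let η : ℂ → Su N := fun z => normalPart X z A
    have hk : ContDiffOn ℝ 1 k U := ((hX.fderiv_one hU).pinv hinj).clm_apply contDiffOn_const
    have hη : IsNormalField U X η := by
      refine ⟨?_, fun z _ => normalPart_mem X z A⟩
      have h1 : ContDiffOn ℝ 1 (fun z => A - fderiv ℝ X z (k z)) U :=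
        contDiffOn_const.sub ((hX.fderiv_one hU).clm_apply hk)
      refine h1.congr fun z hz => ?_
      rw [eq_sub_iff_add_eq']
      exact tangent_add_normalPart (hinj z hz) A
    have hΦη := hΦ.isNormalField η hη
    have hdiff : ∀ {G : Type} [NormedAddCommGroup G] [NormedSpace ℝ G] {g : ℂ → G},
        ContDiffOn ℝ 1 g U → ∀ z ∈ U, HasFDerivAt g (fderiv ℝ g z) z := fun hg z hz =>
      ((hg.differentiableOn one_ne_zero).differentiableAt (hU.mem_nhds hz)).hasFDerivAt
    -- `S` commutes with differentiation of normal fields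
    have hSη : ∀ z ∈ U, ∀ v, fderiv ℝ (fun ζ => Φ ζ (η ζ)) z v = S z (fderiv ℝ η z v) := by
      intro z hz v
      -- The Weingarten relation, from differentiating `⟨dZ(w), ν⟩ = 0`. It reduces the tangential
      -- part of `dν` to products of the second fundamental form with `ν`, which `Φ` preserves.
      have hperp : ∀ {Z ν : ℂ → Su N}, ContDiffOn ℝ 2 Z U → IsNormalField U Z ν → ∀ w,
          inner ℝ (fderiv ℝ Z z w) (fderiv ℝ ν z v) =
            -inner ℝ (fderiv ℝ (fderiv ℝ Z) z v w) (ν z) := by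
        intro Z ν hZ hν w
        have h1 := (((hZ.hasFDerivAt_fderiv hU hz).clm_apply (hasFDerivAt_const w z)).inner ℝ
          (hdiff hν.1 z hz))
        have h2 : (fun y => inner ℝ (fderiv ℝ Z y w) (ν y)) =ᶠ[𝓝 z] fun _ => (0 : ℝ) := by
          filter_upwards [hU.mem_nhds hz] with y hy using mem_normalSpace.1 (hν.2 y hy) w
        have h3 := congrArg (fun B : ℂ →L[ℝ] ℝ => B v)
          (h1.unique ((hasFDerivAt_const (0 : ℝ) z).congr_of_eventuallyEq h2))
        simp at h3
        linarith
      have hpin : pinv (fderiv ℝ Y z) (fderiv ℝ (fun ζ => Φ ζ (η ζ)) z v) =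
          pinv (fderiv ℝ X z) (fderiv ℝ η z v) := by
        refine (pinv_eq_pinv (hinj z hz) (fun a b => (hI z hz a b).symm) fun w => ?_).symm
        rw [hperp hX hη, hperp hY hΦη, hGX hz, hGY hz, inner_add_left, inner_add_left,
          mem_normalSpace.1 (hη.2 z hz), mem_normalSpace.1 (hΦη.2 z hz), hII z hz,
          hΦinner z hz _ (secondForm_mem X z v w) _ (hη.2 z hz)]
      rw [← tangent_add_normalPart (hinjY z hz) (fderiv ℝ (fun ζ => Φ ζ (η ζ)) z v), hpin,
        hΦ.parallel η hη z hz v, hS]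
    have hderiv : ∀ {Z ν : ℂ → Su N}, ContDiffOn ℝ 2 Z U → ContDiffOn ℝ 1 ν U → ∀ z ∈ U, ∀ v,
        fderiv ℝ (fun ζ => fderiv ℝ Z ζ (k ζ) + ν ζ) z v =
          fderiv ℝ Z z (fderiv ℝ k z v) + fderiv ℝ (fderiv ℝ Z) z v (k z) + fderiv ℝ ν z v := by
      intro Z ν hZ hν z hz v
      rw [(((hZ.hasFDerivAt_fderiv hU hz).clm_apply (hdiff hk z hz)).fun_add (hdiff hν z hz)).fderiv]
      simp
    have hSd : DifferentiableOn ℝ (fun z => S z A) U :=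
      (((hY.fderiv_one hU).clm_apply hk).add hΦη.1).differentiableOn one_ne_zero
    refine hU.is_const_of_fderiv_eq_zero (𝕜 := ℝ) hUc.isPreconnected hSd (fun y hy => ?_) hz hz₀
    ext v : 1
    have h1 : fderiv ℝ (fun ζ => fderiv ℝ X ζ (k ζ) + η ζ) y v = 0 := by
      have h2 : (fun ζ => fderiv ℝ X ζ (k ζ) + η ζ) =ᶠ[𝓝 y] fun _ => A := by
        filter_upwards [hU.mem_nhds hy] with x hx using tangent_add_normalPart (hinj x hx) A
      rw [h2.fderiv_eq]
      simp
    rw [hderiv hX hη.1 y hy] at h1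
    change fderiv ℝ (fun ζ => fderiv ℝ Y ζ (k ζ) + Φ ζ (η ζ)) y v = 0
    rw [hderiv hY hΦη.1 y hy, hSη y hy, ← map_zero (S y), ← h1, map_add, map_add, hSt y hy, hGX hy,
      hGY hy, map_add, hSt y hy, hSn y hy _ (secondForm_mem X y v _), hII y hy]
  let L : Su N ≃ₗᵢ[ℝ] Su N :=
    (⟨S z₀, hSnorm z₀ hz₀⟩ : Su N →ₗᵢ[ℝ] Su N).toLinearIsometryEquiv rfl
  refine congruent_of_fderiv_eq hU hUc.isPreconnected (hX.differentiableOn two_ne_zero)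
    (hY.differentiableOn two_ne_zero) L fun z hz v => ?_
  rw [← hSt z hz v, hSconst _ z hz]
  rfl

/-- The fundamental theorem of surface theory, uniqueness part, with the normal bundles compared
by a constant isometry. -/
theorem congruent_iff_secondForm_eq_map (hU : IsOpen U) (hUc : IsConnected U)
    (hX : ContDiffOn ℝ 2 X U) (hY : ContDiffOn ℝ 2 Y U)
    (hinj : ∀ z ∈ U, Function.Injective (fderiv ℝ X z)) :
    Congruent U X Y ↔ (∀ z ∈ U, ∀ v w, firstForm Y z v w = firstForm X z v w) ∧
      ∃ R : Su N ≃ₗᵢ[ℝ] Su N, ∀ z ∈ U, ∀ v w, secondForm Y z v w = R (secondForm X z v w) := by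
  constructor
  · intro h
    obtain ⟨L, c, h⟩ := h.exists_eq_add
    exact ⟨fun z hz => firstForm_eq_of_eq_add hU h hz, L, fun z hz =>
      secondForm_eq_of_eq_add hU h hX hz (hinj z hz)⟩
  · rintro ⟨hI, R, hII⟩
    exact congruent_of_secondForm_eq_map hU hUc hX hY hinj hI R hII

/-- The fundamental theorem of surface theory, uniqueness part, with the normal bundles compared
by a parallel bundle isometry. -/
theorem congruent_iff_isNormalIsometry (hU : IsOpen U) (hUc : IsConnected U)
    (hX : ContDiffOn ℝ 2 X U) (hY : ContDiffOn ℝ 2 Y U)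
    (hinj : ∀ z ∈ U, Function.Injective (fderiv ℝ X z)) :
    Congruent U X Y ↔ (∀ z ∈ U, ∀ v w, firstForm Y z v w = firstForm X z v w) ∧
      ∃ Φ : ℂ → Su N →ₗ[ℝ] Su N, IsNormalIsometry U X Y Φ ∧
        ∀ z ∈ U, ∀ v w, secondForm Y z v w = Φ z (secondForm X z v w) := by
  constructor
  · intro h
    obtain ⟨L, c, h⟩ := h.exists_eq_add
    exact ⟨fun z hz => firstForm_eq_of_eq_add hU h hz, _, isNormalIsometry_of_eq_add hU h hinj,
      fun z hz => secondForm_eq_of_eq_add hU h hX hz (hinj z hz)⟩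
  · rintro ⟨hI, Φ, hΦ, hII⟩
    exact congruent_of_isNormalIsometry hU hUc hX hY hinj hI hΦ hII

end Rigidity

end CPN

namespace CPN

open Complex Matrix
open scoped ComplexOrder

variable {N : ℕ}

/-! ### Second directional derivatives -/

/-- The second derivative of a function on the plane in the direction `v`. -/
def secondDeriv (u : ℂ → ℂ) (z v : ℂ) : ℂ := fderiv ℝ (fun ζ => fderiv ℝ u ζ v) z v

section Scalar

variable {Ω : Set ℂ} {u w : ℂ → ℂ} {z : ℂ}

theorem hasFDerivAt_fderiv_apply (hΩ : IsOpen Ω) (hu : ContDiffOn ℝ 2 u Ω) (hz : z ∈ Ω) (v : ℂ) :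
    HasFDerivAt (fun ζ => fderiv ℝ u ζ v) ((fderiv ℝ (fderiv ℝ u) z).flip v) z := by
  simpa using! (hu.hasFDerivAt_fderiv hΩ hz).clm_apply (hasFDerivAt_const v z)

theorem secondDeriv_eq (hΩ : IsOpen Ω) (hu : ContDiffOn ℝ 2 u Ω) (hz : z ∈ Ω) (v : ℂ) :
    secondDeriv u z v = fderiv ℝ (fderiv ℝ u) z v v := by
  rw [secondDeriv, (hasFDerivAt_fderiv_apply hΩ hu hz v).fderiv]
  rfl

theorem hasFDerivAt_of_contDiffOn_two (hΩ : IsOpen Ω) (hu : ContDiffOn ℝ 2 u Ω) (hz : z ∈ Ω) :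
    HasFDerivAt u (fderiv ℝ u z) z :=
  ((hu.differentiableOn two_ne_zero).differentiableAt (hΩ.mem_nhds hz)).hasFDerivAt

theorem fderiv_mul_apply (hΩ : IsOpen Ω) (hu : ContDiffOn ℝ 2 u Ω) (hw : ContDiffOn ℝ 2 w Ω)
    (hz : z ∈ Ω) (v : ℂ) :
    fderiv ℝ (fun ζ => u ζ * w ζ) z v = fderiv ℝ u z v * w z + u z * fderiv ℝ w z v := by
  rw [((hasFDerivAt_of_contDiffOn_two hΩ hu hz).fun_mul
    (hasFDerivAt_of_contDiffOn_two hΩ hw hz)).fderiv]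
  simp
  ring

theorem secondDeriv_mul (hΩ : IsOpen Ω) (hu : ContDiffOn ℝ 2 u Ω) (hw : ContDiffOn ℝ 2 w Ω)
    (hz : z ∈ Ω) (v : ℂ) :
    secondDeriv (fun ζ => u ζ * w ζ) z v =
      secondDeriv u z v * w z + 2 * (fderiv ℝ u z v * fderiv ℝ w z v) +
        u z * secondDeriv w z v := by
  have h1 : (fun ζ => fderiv ℝ (fun ζ => u ζ * w ζ) ζ v) =ᶠ[𝓝 z]
      fun ζ => fderiv ℝ u ζ v * w ζ + u ζ * fderiv ℝ w ζ v := by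
    filter_upwards [hΩ.mem_nhds hz] with ζ hζ using fderiv_mul_apply hΩ hu hw hζ v
  have h2 := ((hasFDerivAt_fderiv_apply hΩ hu hz v).fun_mul
    (hasFDerivAt_of_contDiffOn_two hΩ hw hz)).fun_add
      ((hasFDerivAt_of_contDiffOn_two hΩ hu hz).fun_mul (hasFDerivAt_fderiv_apply hΩ hw hz v))
  rw [secondDeriv, h1.fderiv_eq, h2.fderiv, secondDeriv_eq hΩ hu hz, secondDeriv_eq hΩ hw hz]
  simp
  ring

/-- The mixed second derivatives cancel by symmetry. This passes from the complex field equations to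
the real Laplacian. -/
theorem wd_wdbar (hΩ : IsOpen Ω) (hu : ContDiffOn ℝ 2 u Ω) (hz : z ∈ Ω) :
    wd (wdbar u) z = (secondDeriv u z 1 + secondDeriv u z I) / 4 := by
  have h1 : HasFDerivAt (wdbar u) ((2 : ℂ)⁻¹ • ((fderiv ℝ (fderiv ℝ u) z).flip 1 +
      I • (fderiv ℝ (fderiv ℝ u) z).flip I)) z := by
    have h2 := ((hasFDerivAt_fderiv_apply hΩ hu hz 1).fun_add
      ((hasFDerivAt_fderiv_apply hΩ hu hz I).const_mul I)).const_mul (2 : ℂ)⁻¹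
    refine h2.congr_of_eventuallyEq (Eventually.of_forall fun ζ => ?_)
    rw [wdbar]
    ring
  rw [wd, h1.fderiv, secondDeriv_eq hΩ hu hz, secondDeriv_eq hΩ hu hz]
  simp [hu.fderiv_fderiv_comm hΩ hz I 1]
  linear_combination (-fderiv ℝ (fderiv ℝ u) z I I / 4) * I_mul_I

theorem fderiv_conj (u : ℂ → ℂ) (z v : ℂ) :
    fderiv ℝ (fun ζ => star (u ζ)) z v = star (fderiv ℝ u z v) := by
  have h := conjCLE.comp_fderiv (f := u) (x := z)
  exact congrArg (fun B : ℂ →L[ℝ] ℂ => B v) h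

theorem secondDeriv_conj (u : ℂ → ℂ) (z v : ℂ) :
    secondDeriv (fun ζ => star (u ζ)) z v = star (secondDeriv u z v) := by
  simp only [secondDeriv, fderiv_conj]

end Scalar

/-! ### The projector -/

section Projector

variable {Ω : Set ℂ} {f : ℂ → Fin (N + 1) → ℂ} {z : ℂ}

/-- The dual homogeneous coordinates `f† / (f† f)`. -/
def dualField (f : ℂ → Fin (N + 1) → ℂ) (z : ℂ) : Fin (N + 1) → ℂ :=
  (star (f z) ⬝ᵥ f z)⁻¹ • star (f z)

theorem proj_eq (f : ℂ → Fin (N + 1) → ℂ) (z : ℂ) :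
    proj f z = 1 - vecMulVec (f z) (dualField f z) := by
  rw [proj, dualField, vecMulVec_smul]

theorem proj_apply (f : ℂ → Fin (N + 1) → ℂ) (z : ℂ) (j k : Fin (N + 1)) :
    proj f z j k = (1 : Mat N) j k - f z j * dualField f z k := by
  rw [proj_eq]
  rfl

theorem star_proj_apply (f : ℂ → Fin (N + 1) → ℂ) (z : ℂ) (j k : Fin (N + 1)) :
    star (proj f z j k) = proj f z k j := by
  have h : star (star (f z) ⬝ᵥ f z) = star (f z) ⬝ᵥ f z := by
    rw [← star_dotProduct_star, star_star, dotProduct_comm]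
  have h1 : star ((1 : Mat N) j k) = (1 : Mat N) k j := by
    rw [← conjTranspose_apply, conjTranspose_one]
  simp only [proj_apply, star_sub, star_mul, dualField, Pi.smul_apply, smul_eq_mul, star_inv₀, h,
    Pi.star_apply, star_star, h1]
  ring

theorem conjTranspose_proj (f : ℂ → Fin (N + 1) → ℂ) (z : ℂ) : (proj f z)ᴴ = proj f z := by
  ext j k
  exact star_proj_apply f z k j

namespace IsSolution

theorem contDiffOn_apply (hf : IsSolution Ω f) (j : Fin (N + 1)) :
    ContDiffOn ℝ 2 (fun ζ => f ζ j) Ω :=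
  contDiffOn_pi.1 hf.contDiffOn j

theorem norm_ne_zero (hf : IsSolution Ω f) (hz : z ∈ Ω) : star (f z) ⬝ᵥ f z ≠ 0 :=
  fun h => hf.ne_zero z hz (dotProduct_star_self_eq_zero.1 h)

theorem contDiffOn_dualField (hf : IsSolution Ω f) (k : Fin (N + 1)) :
    ContDiffOn ℝ 2 (fun ζ => dualField f ζ k) Ω := by
  have hconj : ∀ j, ContDiffOn ℝ 2 (fun ζ => star (f ζ j)) Ω := fun j =>
    conjCLE.contDiff.comp_contDiffOn (hf.contDiffOn_apply j)
  have hsum : ContDiffOn ℝ 2 (fun ζ => star (f ζ) ⬝ᵥ f ζ) Ω :=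
    ContDiffOn.sum fun j _ => (hconj j).mul (hf.contDiffOn_apply j)
  exact (hsum.inv fun ζ hζ => hf.norm_ne_zero hζ).mul (hconj k)

theorem dualField_dotProduct (hf : IsSolution Ω f) (hz : z ∈ Ω) : dualField f z ⬝ᵥ f z = 1 := by
  rw [dualField, smul_dotProduct, smul_eq_mul, inv_mul_cancel₀ (hf.norm_ne_zero hz)]

theorem contDiffOn_proj (hf : IsSolution Ω f) (j k : Fin (N + 1)) :
    ContDiffOn ℝ 2 (fun ζ => proj f ζ j k) Ω := by
  simp only [proj_apply]
  exact contDiffOn_const.sub ((hf.contDiffOn_apply j).mul (hf.contDiffOn_dualField k))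

theorem proj_mulVec_self (hf : IsSolution Ω f) (hz : z ∈ Ω) : proj f z *ᵥ f z = 0 := by
  rw [proj_eq, sub_mulVec, one_mulVec, vecMulVec_mulVec, hf.dualField_dotProduct hz]
  simp

/-- The derivative of the relation `f† f / (f† f) = 1`. -/
theorem fderiv_dualField_dotProduct (hΩ : IsOpen Ω) (hf : IsSolution Ω f) (hz : z ∈ Ω) (v : ℂ) :
    (fun k => fderiv ℝ (fun ζ => dualField f ζ k) z v) ⬝ᵥ f z =
      -(dualField f z ⬝ᵥ fun k => fderiv ℝ (fun ζ => f ζ k) z v) := by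
  have h1 : HasFDerivAt (fun ζ => ∑ k, dualField f ζ k * f ζ k)
      (∑ k, (dualField f z k • fderiv ℝ (fun ζ => f ζ k) z +
        f z k • fderiv ℝ (fun ζ => dualField f ζ k) z)) z :=
    HasFDerivAt.fun_sum fun k _ =>
      (hasFDerivAt_of_contDiffOn_two hΩ (hf.contDiffOn_dualField k) hz).fun_mul
        (hasFDerivAt_of_contDiffOn_two hΩ (hf.contDiffOn_apply k) hz)
  have h2 : (fun ζ => ∑ k, dualField f ζ k * f ζ k) =ᶠ[𝓝 z] fun _ => (1 : ℂ) := by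
    filter_upwards [hΩ.mem_nhds hz] with ζ hζ using hf.dualField_dotProduct hζ
  have h3 := congrArg (fun B : ℂ →L[ℝ] ℂ => B v)
    (h1.unique ((hasFDerivAt_const (1 : ℂ) z).congr_of_eventuallyEq h2))
  simp [Finset.sum_add_distrib] at h3
  rw [eq_neg_iff_add_eq_zero, ← h3, add_comm]
  simp [dotProduct, mul_comm]

end IsSolution

/-- The derivative of the projector in the direction `v`. -/
def projDeriv (f : ℂ → Fin (N + 1) → ℂ) (z v : ℂ) : Mat N :=
  Matrix.of fun j k => fderiv ℝ (fun ζ => proj f ζ j k) z v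

/-- The second derivative of the projector in the direction `v`. -/
def projSecondDeriv (f : ℂ → Fin (N + 1) → ℂ) (z v : ℂ) : Mat N :=
  Matrix.of fun j k => secondDeriv (fun ζ => proj f ζ j k) z v

/-- The Laplacian of the projector. -/
def projLaplacian (f : ℂ → Fin (N + 1) → ℂ) (z : ℂ) : Mat N :=
  projSecondDeriv f z 1 + projSecondDeriv f z I

theorem conjTranspose_projDeriv (f : ℂ → Fin (N + 1) → ℂ) (z v : ℂ) :
    (projDeriv f z v)ᴴ = projDeriv f z v := by
  ext j k
  rw [conjTranspose_apply, projDeriv, of_apply, of_apply, ← fderiv_conj]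
  simp only [star_proj_apply]

theorem conjTranspose_projSecondDeriv (f : ℂ → Fin (N + 1) → ℂ) (z v : ℂ) :
    (projSecondDeriv f z v)ᴴ = projSecondDeriv f z v := by
  ext j k
  rw [conjTranspose_apply, projSecondDeriv, of_apply, of_apply, ← secondDeriv_conj]
  simp only [star_proj_apply]

theorem conjTranspose_projLaplacian (f : ℂ → Fin (N + 1) → ℂ) (z : ℂ) :
    (projLaplacian f z)ᴴ = projLaplacian f z := by
  rw [projLaplacian, conjTranspose_add, conjTranspose_projSecondDeriv,
    conjTranspose_projSecondDeriv]

namespace IsSolution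

theorem secondDeriv_proj (hΩ : IsOpen Ω) (hf : IsSolution Ω f) (hz : z ∈ Ω) (v : ℂ)
    (j k : Fin (N + 1)) :
    secondDeriv (fun ζ => proj f ζ j k) z v =
      -(secondDeriv (fun ζ => f ζ j) z v * dualField f z k +
        2 * (fderiv ℝ (fun ζ => f ζ j) z v * fderiv ℝ (fun ζ => dualField f ζ k) z v) +
        f z j * secondDeriv (fun ζ => dualField f ζ k) z v) := by
  rw [← secondDeriv_mul hΩ (hf.contDiffOn_apply j) (hf.contDiffOn_dualField k) hz]
  simp only [secondDeriv, proj_apply, fderiv_const_sub, _root_.neg_apply, fderiv_fun_neg]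

/-- The equations of the model: `P ΔP` annihilates `f`. -/
theorem proj_mulVec_projLaplacian (hΩ : IsOpen Ω) (hf : IsSolution Ω f) (hz : z ∈ Ω) :
    proj f z *ᵥ (projLaplacian f z *ᵥ f z) = 0 := by
  let F1 : ℂ → Fin (N + 1) → ℂ := fun v k => fderiv ℝ (fun ζ => f ζ k) z v
  let F2 : ℂ → Fin (N + 1) → ℂ := fun v k => secondDeriv (fun ζ => f ζ k) z v
  let H1 : ℂ → Fin (N + 1) → ℂ := fun v k => fderiv ℝ (fun ζ => dualField f ζ k) z v
  let H2 : ℂ → Fin (N + 1) → ℂ := fun v k => secondDeriv (fun ζ => dualField f ζ k) z v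
  let h := dualField f z
  have hH : ∀ v, H1 v ⬝ᵥ f z = -(h ⬝ᵥ F1 v) := hf.fderiv_dualField_dotProduct hΩ hz
  have hL : projLaplacian f z =
      -(vecMulVec (F2 1) h + (2 : ℂ) • vecMulVec (F1 1) (H1 1) + vecMulVec (f z) (H2 1) +
        (vecMulVec (F2 I) h + (2 : ℂ) • vecMulVec (F1 I) (H1 I) + vecMulVec (f z) (H2 I))) := by
    ext j k
    rw [projLaplacian, Matrix.add_apply, projSecondDeriv, projSecondDeriv, of_apply, of_apply,
      hf.secondDeriv_proj hΩ hz, hf.secondDeriv_proj hΩ hz]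
    simp [vecMulVec_apply, F1, F2, H1, H2, h]
    ring
  -- `hH` moves the derivative off the dual field, producing the first-order terms of the model; the
  -- remaining multiple of `f` is killed by `P`.
  have hLf : projLaplacian f z *ᵥ f z =
      -(F2 1 + F2 I - (2 : ℂ) • ((h ⬝ᵥ F1 1) • F1 1 + (h ⬝ᵥ F1 I) • F1 I)) -
        (H2 1 ⬝ᵥ f z + H2 I ⬝ᵥ f z) • f z := by
    rw [hL]
    simp only [neg_mulVec, add_mulVec, smul_mulVec, vecMulVec_mulVec, hH,
      hf.dualField_dotProduct hz, h]
    ext j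
    simp
    ring
  have hE := hf.eulerLagrange z hz
  -- In the symmetrized product of `∂f` and `∂̄f` the cross terms between the directions `1` and `I`
  -- cancel.
  have hE' : (fun j => wd (wdbar fun ζ => f ζ j) z) - (star (f z) ⬝ᵥ f z)⁻¹ •
      ((star (f z) ⬝ᵥ fun j => wdbar (fun ζ => f ζ j) z) • (fun j => wd (fun ζ => f ζ j) z) +
        (star (f z) ⬝ᵥ fun j => wd (fun ζ => f ζ j) z) • fun j => wdbar (fun ζ => f ζ j) z) =
      (4 : ℂ)⁻¹ • (F2 1 + F2 I - (2 : ℂ) • ((h ⬝ᵥ F1 1) • F1 1 + (h ⬝ᵥ F1 I) • F1 I)) := by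
    have hd : (fun j => wd (fun ζ => f ζ j) z) = (2 : ℂ)⁻¹ • (F1 1 - I • F1 I) := by
      ext j
      simp [wd, F1]
      ring
    have hdb : (fun j => wdbar (fun ζ => f ζ j) z) = (2 : ℂ)⁻¹ • (F1 1 + I • F1 I) := by
      ext j
      simp [wdbar, F1]
      ring
    rw [hd, hdb]
    ext j
    simp only [Pi.sub_apply, Pi.add_apply, Pi.smul_apply, smul_eq_mul, dotProduct_smul,
      dotProduct_add, dotProduct_sub, h, dualField, smul_dotProduct,
      wd_wdbar hΩ (hf.contDiffOn_apply j) hz, F2]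
    linear_combination ((1 / 2) * (star (f z) ⬝ᵥ f z)⁻¹ * (star (f z) ⬝ᵥ F1 I) * F1 I j) * I_mul_I
  simp only at hE
  rw [hE', mulVec_smul] at hE
  rw [hLf, mulVec_sub, mulVec_neg, mulVec_smul, hf.proj_mulVec_self hz, smul_zero, sub_zero,
    neg_eq_zero]
  exact (smul_eq_zero.1 hE).resolve_left (by norm_num)

/-- The equations of the model as a conservation law: `[ΔP, P] = 0`. -/
theorem lie_projLaplacian_proj (hΩ : IsOpen Ω) (hf : IsSolution Ω f) (hz : z ∈ Ω) :
    ⁅projLaplacian f z, proj f z⁆ = 0 := by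
  set Q : Mat N := vecMulVec (f z) (dualField f z) with hQ
  have hPQ : proj f z + Q = 1 := by rw [proj_eq, sub_add_cancel]
  -- `Q` has range spanned by `f`, so the field equation kills one off-diagonal block of `ΔP`;
  -- Hermitian symmetry kills the other.
  have h1 : proj f z * projLaplacian f z * Q = 0 := by
    rw [hQ, mul_vecMulVec, ← mulVec_mulVec, hf.proj_mulVec_projLaplacian hΩ hz, zero_vecMulVec]
  have hQs : Qᴴ = Q := by
    rw [← add_right_inj (proj f z), hPQ]
    nth_rw 1 [← conjTranspose_proj f z]
    rw [← conjTranspose_add, hPQ, conjTranspose_one]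
  have h2 : Q * projLaplacian f z * proj f z = 0 := by
    have h3 := congrArg conjTranspose h1
    rwa [conjTranspose_mul, conjTranspose_mul, hQs, conjTranspose_proj,
      conjTranspose_projLaplacian, conjTranspose_zero, ← mul_assoc] at h3
  have h3 : projLaplacian f z * proj f z = proj f z * projLaplacian f z * proj f z := by
    conv_lhs => rw [← one_mul (projLaplacian f z), ← hPQ, add_mul, add_mul, h2, add_zero]
  have h4 : proj f z * projLaplacian f z = proj f z * projLaplacian f z * proj f z := by
    conv_lhs => rw [← mul_one (proj f z * projLaplacian f z), ← hPQ, mul_add, h1, add_zero]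
  rw [Ring.lie_def, h3, ← h4, sub_self]

end IsSolution

end Projector

end CPN

namespace CPN

open Complex Matrix
open scoped ComplexOrder

variable {N : ℕ}

/-! ### Calculus in `su(N+1)` -/

/-- The entries of an element of `su(N+1)`. -/
def Su.entry (j k : Fin (N + 1)) : Su N →L[ℝ] ℂ :=
  LinearMap.toContinuousLinearMap
    { toFun := fun A => A.mat j k
      map_add' := fun A B => by rw [map_add]; rfl
      map_smul' := fun c A => by rw [map_smul]; rfl }

theorem Su.entry_apply (j k : Fin (N + 1)) (A : Su N) : Su.entry j k A = A.mat j k := rfl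

theorem Su.ext_entry {A B : Su N} (h : ∀ j k, Su.entry j k A = Su.entry j k B) : A = B :=
  Su.mat_injective (Matrix.ext h)

/-- The entries embed `su(N+1)` linearly in a product of copies of `ℂ`, and a linear left inverse is
continuous in finite dimension, whatever the norms. -/
theorem contDiffOn_of_entry {E : Type*} [NormedAddCommGroup E] [NormedSpace ℝ E]
    {n : WithTop ℕ∞} {X : E → Su N} {s : Set E}
    (h : ∀ j k, ContDiffOn ℝ n (fun z => (X z).mat j k) s) : ContDiffOn ℝ n X s := by
  let e : Su N →ₗ[ℝ] Fin (N + 1) → Fin (N + 1) → ℂ := Su.mat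
  obtain ⟨l, hl⟩ := e.exists_leftInverse_of_injective (LinearMap.ker_eq_bot.2 Su.mat_injective)
  have h1 : ContDiffOn ℝ n (fun z => e (X z)) s :=
    contDiffOn_pi.2 fun j => contDiffOn_pi.2 fun k => h j k
  refine (l.toContinuousLinearMap.contDiff.comp_contDiffOn h1).congr fun z _ => ?_
  exact (LinearMap.congr_fun hl (X z)).symm

theorem fderiv_mat_apply {X : ℂ → Su N} {z : ℂ} (hX : DifferentiableAt ℝ X z) (v : ℂ)
    (j k : Fin (N + 1)) : fderiv ℝ (fun ζ => (X ζ).mat j k) z v = (fderiv ℝ X z v).mat j k := by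
  have h := ((Su.entry j k).hasFDerivAt.comp z hX.hasFDerivAt).fderiv
  exact congrArg (fun B : ℂ →L[ℝ] ℂ => B v) h

/-! ### The Weierstrass form -/

section Form

variable {Ω : Set ℂ} {f : ℂ → Fin (N + 1) → ℂ} {z : ℂ}

theorem commutator_add (A B C : Mat N) : ⁅A + B, C⁆ = ⁅A, C⁆ + ⁅B, C⁆ := by
  simp only [Ring.lie_def]
  noncomm_ring

theorem commutator_neg (A C : Mat N) : ⁅-A, C⁆ = -⁅A, C⁆ := by
  simp only [Ring.lie_def]
  noncomm_ring

theorem projDeriv_add (f : ℂ → Fin (N + 1) → ℂ) (z v w : ℂ) :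
    projDeriv f z (v + w) = projDeriv f z v + projDeriv f z w := by
  ext j k
  simp [projDeriv]

theorem projDeriv_smul (f : ℂ → Fin (N + 1) → ℂ) (z : ℂ) (c : ℝ) (v : ℂ) :
    projDeriv f z (c • v) = c • projDeriv f z v := by
  ext j k
  simp only [projDeriv, map_smul, of_apply, Matrix.smul_apply]

theorem lie_projDeriv_mem (f : ℂ → Fin (N + 1) → ℂ) (z v : ℂ) :
    ⁅projDeriv f z v, proj f z⁆ ∈ suSubmodule N := by
  constructor
  · rw [Ring.lie_def, conjTranspose_sub, conjTranspose_mul, conjTranspose_mul,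
      conjTranspose_projDeriv, conjTranspose_proj, neg_sub]
  · rw [Ring.lie_def, trace_sub, trace_mul_comm, sub_self]

/-- The form `i (-[∂P, P] dξ + [∂̄P, P] dξ̄)` with values in `su(N+1)`. In real terms, its value at
`v` is `[dP (-i v), P]`. -/
def suForm (f : ℂ → Fin (N + 1) → ℂ) (z : ℂ) : ℂ →L[ℝ] Su N :=
  LinearMap.toContinuousLinearMap
    { toFun := fun v =>
        (⟨⁅projDeriv f z (-I * v), proj f z⁆, lie_projDeriv_mem f z _⟩ : suSubmodule N)
      map_add' := fun v w => Subtype.ext (show ⁅projDeriv f z (-I * (v + w)), proj f z⁆ =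
          ⁅projDeriv f z (-I * v), proj f z⁆ + ⁅projDeriv f z (-I * w), proj f z⁆ by
        rw [mul_add, projDeriv_add, commutator_add])
      map_smul' := fun c v => Subtype.ext (show ⁅projDeriv f z (-I * (c • v)), proj f z⁆ =
          c • ⁅projDeriv f z (-I * v), proj f z⁆ by
        rw [mul_smul_comm, projDeriv_smul, Ring.lie_def, smul_mul_assoc, mul_smul_comm,
          ← smul_sub, ← Ring.lie_def]) }

theorem suForm_mat (f : ℂ → Fin (N + 1) → ℂ) (z v : ℂ) :
    (suForm f z v).mat = ⁅projDeriv f z (-I * v), proj f z⁆ := rfl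

/-- Both sides are the commutator of `(Im v) ∂₁P - (Re v) ∂₂P` with `P`. This is why the complex
formula takes values in `su(N+1)`. -/
theorem suForm_mat_apply (f : ℂ → Fin (N + 1) → ℂ) (z v : ℂ) (j k : Fin (N + 1)) :
    (suForm f z v).mat j k = weierstrassForm f j k z v := by
  have hd : dProj f z = (2 : ℂ)⁻¹ • (projDeriv f z 1 - I • projDeriv f z I) := by
    ext j k
    simp [dProj, projDeriv, wd]
    ring
  have hdb : dbarProj f z = (2 : ℂ)⁻¹ • (projDeriv f z 1 + I • projDeriv f z I) := by
    ext j k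
    simp [dbarProj, projDeriv, wdbar]
    ring
  have hv : projDeriv f z (-I * v) = (v.im : ℂ) • projDeriv f z 1 - (v.re : ℂ) • projDeriv f z I := by
    have h1 : -I * v = v.im • (1 : ℂ) + (-v.re) • I := by
      apply Complex.ext <;> simp
    rw [h1, projDeriv_add, projDeriv_smul, projDeriv_smul]
    ext j k
    simp
    ring
  rw [suForm_mat, weierstrassForm, hd, hdb, hv]
  simp only [Ring.lie_def, sub_mul, mul_sub, add_mul, mul_add, smul_mul_assoc, mul_smul_comm,
    _root_.smul_apply, _root_.add_apply, ContinuousLinearMap.id_apply,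
    Matrix.sub_apply, Matrix.add_apply, Matrix.smul_apply, smul_eq_mul,
    ContinuousLinearEquiv.coe_coe, conjCLE_apply]
  have h2 : v = v.re + v.im * I := (re_add_im v).symm
  have h3 : (starRingEnd ℂ) v = v.re - v.im * I := by
    apply Complex.ext <;> simp
  rw [h3]
  generalize v.re = a at *
  generalize v.im = b at *
  subst h2
  linear_combination (b * ((projDeriv f z 1 * proj f z) j k - (proj f z * projDeriv f z 1) j k) -
    a * ((projDeriv f z I * proj f z) j k - (proj f z * projDeriv f z I) j k)) * I_mul_I

theorem IsSolution.contDiffOn_projDeriv (hΩ : IsOpen Ω) (hf : IsSolution Ω f) (v : ℂ)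
    (j k : Fin (N + 1)) : ContDiffOn ℝ 1 (fun ζ => projDeriv f ζ v j k) Ω :=
  ((hf.contDiffOn_proj j k).fderiv_one hΩ).clm_apply contDiffOn_const

theorem IsSolution.contDiffOn_suForm (hΩ : IsOpen Ω) (hf : IsSolution Ω f) :
    ContDiffOn ℝ 1 (suForm f) Ω := by
  refine contDiffOn_clm_apply.2 fun v => contDiffOn_of_entry fun j k => ?_
  simp only [suForm_mat, Ring.lie_def, Matrix.sub_apply, Matrix.mul_apply]
  have hP : ∀ j k, ContDiffOn ℝ 1 (fun ζ => proj f ζ j k) Ω := fun j k =>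
    (hf.contDiffOn_proj j k).of_le one_le_two
  exact (ContDiffOn.sum fun l _ => (hf.contDiffOn_projDeriv hΩ _ j l).mul (hP l k)).sub
    (ContDiffOn.sum fun l _ => (hP j l).mul (hf.contDiffOn_projDeriv hΩ _ l k))

/-- The derivative of `[∂ᵥP, P]` in the direction `v` is `[∂ᵥ²P, P]`. -/
theorem IsSolution.fderiv_lie_projDeriv (hΩ : IsOpen Ω) (hf : IsSolution Ω f) (hz : z ∈ Ω)
    (v : ℂ) (j k : Fin (N + 1)) :
    fderiv ℝ (fun ζ => ⁅projDeriv f ζ v, proj f ζ⁆ j k) z v =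
      ⁅projSecondDeriv f z v, proj f z⁆ j k := by
  have hP : ∀ j k, HasFDerivAt (fun ζ => proj f ζ j k) (fderiv ℝ (fun ζ => proj f ζ j k) z) z :=
    fun j k => hasFDerivAt_of_contDiffOn_two hΩ (hf.contDiffOn_proj j k) hz
  have hD : ∀ j k, HasFDerivAt (fun ζ => projDeriv f ζ v j k)
      (fderiv ℝ (fun ζ => fderiv ℝ (fun ζ => proj f ζ j k) ζ v) z) z := fun j k =>
    ((hasFDerivAt_fderiv_apply hΩ (hf.contDiffOn_proj j k) hz v).differentiableAt).hasFDerivAt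
  have h := (HasFDerivAt.fun_sum fun l (_ : l ∈ Finset.univ) => (hD j l).fun_mul (hP l k)).fun_sub
    (HasFDerivAt.fun_sum fun l (_ : l ∈ Finset.univ) => (hP j l).fun_mul (hD l k))
  have h1 : (fun ζ => ⁅projDeriv f ζ v, proj f ζ⁆ j k) = fun ζ =>
      ∑ l, projDeriv f ζ v j l * proj f ζ l k - ∑ l, proj f ζ j l * projDeriv f ζ v l k := by
    ext ζ
    simp only [Ring.lie_def, Matrix.sub_apply, Matrix.mul_apply]
  rw [h1, h.fderiv]
  simp only [Ring.lie_def, Matrix.sub_apply, Matrix.mul_apply, of_apply, projDeriv, projSecondDeriv,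
    secondDeriv]
  -- The products of first derivatives cancel, since `[∂ᵥP, ∂ᵥP] = 0`.
  simp [Finset.sum_add_distrib, mul_comm]
  ring

/-- The Weierstrass form is closed. -/
theorem IsSolution.fderiv_suForm_comm (hΩ : IsOpen Ω) (hf : IsSolution Ω f) (hz : z ∈ Ω)
    (v w : ℂ) : fderiv ℝ (suForm f) z v w = fderiv ℝ (suForm f) z w v := by
  have hd : DifferentiableAt ℝ (suForm f) z :=
    ((hf.contDiffOn_suForm hΩ).differentiableOn one_ne_zero).differentiableAt (hΩ.mem_nhds hz)
  have hentry : ∀ a b j k, (fderiv ℝ (suForm f) z a b).mat j k =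
      fderiv ℝ (fun ζ => (suForm f ζ b).mat j k) z a := by
    intro a b j k
    have h1 := hd.hasFDerivAt.clm_apply (hasFDerivAt_const b z)
    rw [fderiv_mat_apply h1.differentiableAt, h1.fderiv]
    simp
  -- The form is `-[∂₂P, P]` on `1` and `[∂₁P, P]` on `I`, so its curl is `∂₁[∂₁P, P] + ∂₂[∂₂P, P] =
  -- [ΔP, P]`. By bilinearity this pair of directions suffices.
  have h1I : fderiv ℝ (suForm f) z 1 I = fderiv ℝ (suForm f) z I 1 := by
    refine Su.ext_entry fun j k => ?_
    have hL := congrFun (congrFun (hf.lie_projLaplacian_proj hΩ hz) j) k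
    rw [projLaplacian, commutator_add, Matrix.add_apply, ← hf.fderiv_lie_projDeriv hΩ hz,
      ← hf.fderiv_lie_projDeriv hΩ hz] at hL
    rw [Su.entry_apply, Su.entry_apply, hentry, hentry]
    have h2 : ∀ ζ, projDeriv f ζ (-I * 1) = -projDeriv f ζ I := fun ζ => by
      ext j k
      simp [projDeriv]
    have h3 : -I * I = 1 := by rw [neg_mul, I_mul_I, neg_neg]
    simp only [suForm_mat, h2, h3, commutator_neg, Matrix.neg_apply, fderiv_fun_neg]
    exact eq_neg_of_add_eq_zero_left hL
  have hbasis : ∀ a : ℂ, a = a.re • (1 : ℂ) + a.im • I := fun a => by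
    apply Complex.ext <;> simp
  rw [hbasis v, hbasis w]
  simp only [map_add, map_smul, _root_.add_apply, _root_.smul_apply, h1I,
    smul_add, smul_smul]
  module

end Form

end CPN

end

/-! ### The Weierstrass surface and its rigidity -/

theorem mainTheorem4 (N : ℕ) (Ω : Set ℂ) (hΩ : IsOpen Ω) (hΩc : IsSimplyConnected Ω)
    (f : ℂ → Fin (N + 1) → ℂ) (hf : CPN.IsSolution Ω f) (ξ₀ : ℂ) (hξ₀ : ξ₀ ∈ Ω) :
    (∃ X : ℂ → CPN.Su N, CPN.IsWeierstrassMap Ω f ξ₀ X) ∧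
    ∀ X : ℂ → CPN.Su N, CPN.IsWeierstrassMap Ω f ξ₀ X →
      ContDiffOn ℝ 2 X Ω ∧
      (∀ z ∈ Ω, ∀ v j k, (fderiv ℝ X z v).mat j k = CPN.weierstrassForm f j k z v) ∧
      (∀ z ∈ Ω, CPN.metricDet X z ≠ 0 → Function.Injective (fderiv ℝ X z)) ∧
      ∀ U : Set ℂ, IsOpen U → IsConnected U → U ⊆ Ω → (∀ z ∈ U, CPN.metricDet X z ≠ 0) →
        ∀ Y : ℂ → CPN.Su N, ContDiffOn ℝ 2 Y U →
          (CPN.Congruent U X Y ↔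
            (∀ z ∈ U, ∀ v w, CPN.firstForm Y z v w = CPN.firstForm X z v w) ∧
            ∃ R : CPN.Su N ≃ₗᵢ[ℝ] CPN.Su N, ∀ z ∈ U, ∀ v w,
              CPN.secondForm Y z v w = R (CPN.secondForm X z v w)) ∧
          (CPN.Congruent U X Y ↔
            (∀ z ∈ U, ∀ v w, CPN.firstForm Y z v w = CPN.firstForm X z v w) ∧
            ∃ Φ : ℂ → CPN.Su N →ₗ[ℝ] CPN.Su N, CPN.IsNormalIsometry U X Y Φ ∧
              ∀ z ∈ U, ∀ v w, CPN.secondForm Y z v w = Φ z (CPN.secondForm X z v w)) := by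
  obtain ⟨G, hG⟩ := hΩc.exists_forall_hasFDerivAt_of_fderiv_symmetric hΩ
    ((hf.contDiffOn_suForm hΩ).differentiableOn one_ne_zero)
    (fun z hz v w => hf.fderiv_suForm_comm hΩ hz v w)
  have hform : ∀ j k z, CPN.weierstrassForm f j k z = CPN.Su.entry j k ∘L CPN.suForm f z :=
    fun j k z => by
      ext v : 1
      exact (CPN.suForm_mat_apply f z v j k).symm
  have hint : ∀ ξ, ∀ γ : Path ξ₀ ξ, (∀ s, γ s ∈ Ω) → CPN.PiecewiseC1 γ → ∀ j k,
      CurveIntegrable (CPN.weierstrassForm f j k) γ ∧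
        curveIntegral (CPN.weierstrassForm f j k) γ = (G ξ - G ξ₀).mat j k := by
    intro ξ γ hγ hγ' j k
    have h := hγ'.curveIntegral_eq_sub (ω := CPN.weierstrassForm f j k)
      (G := fun z => CPN.Su.entry j k (G z)) (Ω := Ω)
      (by
        rw [funext (hform j k)]
        exact continuousOn_const.clm_comp (hf.contDiffOn_suForm hΩ).continuousOn)
      (fun z hz => by
        rw [hform]
        exact (CPN.Su.entry j k).hasFDerivAt.comp z (hG z hz)) hγ
    rw [← map_sub] at h
    exact h
  refine ⟨⟨fun z => G z - G ξ₀, fun ξ _ γ hγ hγ' j k => ?_⟩, fun X hX => ?_⟩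
  · obtain ⟨h1, h2⟩ := hint ξ γ hγ hγ' j k
    exact ⟨h1, h2.symm⟩
  -- The integral formula determines `X` on `Ω` because an admissible curve reaches every point;
  -- values outside `Ω` stay arbitrary.
  have hXG : ∀ z ∈ Ω, X z = G z - G ξ₀ := fun z hz => by
    obtain ⟨γ, hγ, hγ'⟩ := CPN.exists_piecewiseC1 hΩ
      hΩc.isPathConnected.isConnected.isPreconnected hξ₀ hz
    exact CPN.Su.ext_entry fun j k => (hX z hz γ hγ hγ' j k).2.trans (hint z γ hγ hγ' j k).2
  have hXd : ∀ z ∈ Ω, HasFDerivAt X (CPN.suForm f z) z := fun z hz =>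
    ((hG z hz).sub_const (G ξ₀)).congr_of_eventuallyEq
      (by filter_upwards [hΩ.mem_nhds hz] with y hy using hXG y hy)
  have hX2 : ContDiffOn ℝ 2 X Ω := by
    rw [show (2 : WithTop ℕ∞) = 1 + 1 from one_add_one_eq_two.symm,
      contDiffOn_succ_iff_fderiv_of_isOpen hΩ]
    exact ⟨fun z hz => (hXd z hz).differentiableAt.differentiableWithinAt, by simp,
      (hf.contDiffOn_suForm hΩ).congr fun z hz => (hXd z hz).fderiv⟩
  refine ⟨hX2, fun z hz v j k => ?_, fun z _ h => CPN.injective_fderiv_of_metricDet_ne_zero h,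
    fun U hU hUc hUΩ hdet Y hY => ?_⟩
  · rw [(hXd z hz).fderiv, CPN.suForm_mat_apply]
  · have hinj : ∀ z ∈ U, Function.Injective (fderiv ℝ X z) := fun z hz =>
      CPN.injective_fderiv_of_metricDet_ne_zero (hdet z hz)
    exact ⟨CPN.congruent_iff_secondForm_eq_map hU hUc (hX2.mono hUΩ) hY hinj,
      CPN.congruent_iff_isNormalIsometry hU hUc (hX2.mono hUΩ) hY hinj⟩
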